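/- **Setting.** Fix sets $\mathcal K_+$, $\mathcal K_-$ of positive and negative instructions. Values, terms and commands of the focalising system $\mathbf L$ are given by $V ::= V_+ \mid t_-$, $\;V_+ ::= x\mid (V,V')\mid\{V\}\mid k_+$, $\;t_+ ::= V_+\mid\mu\alpha.c$, $\;t_- ::= \alpha\mid\mu(\kappa,\kappa').c\mid\mu\{\kappa\}.c\mid\mu x.c\mid k_-$, $\;c ::= \langle t_+|t_-\rangle=\langle t_-|t_+\rangle$, modulo $\alpha$-equivalence, where $x$ is a positive variable, $\alpha$ a negative one, $\kappa,\kappa'$ are of any polarity, $k_\pm\in\mathcal K_\pm$. The reduction $\to_0$ is the union of $\langle\mu\alpha.c|t_-\rangle\to_\mu c[t_- /\alpha]$, $\langle V_+|\mu x.c\rangle\to_\mu c[V_+/x]$, $\langle\{V\}|\mu\{\kappa\}.c\rangle\to_\beta c[V/\kappa]$, $\langle(V,V')|\mu(\kappa,\kappa').c\rangle\to_\beta c[V/\kappa,V'/\kappa']$ (the last two when polarities match). Kinds are $\sigma,\tau::=\iota\mid o^+\mid o^-\mid\sigma\to\tau$, with $\iota^\bot=\iota$, $(o^{\pm})^\bot=o^{\mp}$,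 $(\sigma\to\tau)^\bot=\sigma\to\tau^\bot$. Constructors are the well-kinded expressions built from $x^\tau$, $(x^\tau)^\bot:\tau^\bot$, $\lambda$, application, $\mathbf 0:\iota$, $\mathbf s:\iota\to\iota$, $rec_\tau:\tau\to(\iota\to\tau\to\tau)\to\iota\to\tau$, $rec_\tau^\bot:\tau\to(\iota\to\tau\to\tau)\to\iota\to\tau^\bot$, $A\otimes B,\ {\downarrow}A:o^+$, $A\parr B,\ {\uparrow}A:o^-$ and $\forall x^\tau.A,\ \exists x^\tau.A$ (of the polarity of $A$), with the De Morgan negation $(\cdot)^\bot$; on constructors $(\lambda x.T)^\bot=\lambda x.T^\bot$, $(TU)^\bot=T^\bot U$, $\mathbf 0^\bot=\mathbf 0$, $\mathbf s^\bot=\mathbf s$. Formulas are the constructors of kind $o^\pm$; $P$ denotes a positive, $N$ a negative one. $\cong$ is the congruence between constructors of the same kind generated by $\beta$, $\eta$, $rec_\tau TU\mathbf 0\cong T$, $rec_\tau TU(\mathbf s n)\cong U\,n\,(rec_\tau TUn)$, $rec^\bot_\tau TU\mathbf 0\cong T^\bot$, $rec^\bot_\tau TU(\mathbf s n)\cong U^\bot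 n\,(rec_\tau TUn)$. Contexts $\Gamma$ are finite sets of declarations $x:N$, $\alpha:P$; judgments are $c:(\vdash\Gamma)$ and $\vdash t:B\mid\Gamma$, with $t$ of the polarity of $B$ and all free variables of $c$, $t$ declared in $\Gamma$. A comma between contexts means that they declare distinct variables. The rules of $\mathrm{PA}\omega$ are those of $\mathrm{MAL}\omega$: $(Ax_+)$ $\vdash x:P\mid x:P^\bot$; $(Ax_-)$ $\vdash\alpha:N\mid\alpha:N^\bot$; $(\mu_+)$ from $c:(\vdash\alpha:P,\Gamma)$ infer $\vdash\mu\alpha.c:P\mid\Gamma$; $(\mu_-)$ from $c:(\vdash x:N,\Gamma)$ infer $\vdash\mu x.c:N\mid\Gamma$; $(Cut)$ from $\vdash t:A\mid\Gamma$ and $\vdash u:A^\bot\mid\Delta$ infer $\langle t|u\rangle:(\vdash\Gamma,\Delta)$; $(\otimes)$ from $\vdash V:A\mid\Gamma$ and $\vdash V':B\mid\Delta$ infer $\vdash(V,V'):A\otimes B\mid\Gamma,\Delta$; $(\parr)$ from $c:(\vdash\kappa:A,\kappa':B,\Gamma)$ infer $\vdash\mu(\kappa,\kappa').c:A\parr B\mid\Gamma$;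 $(\downarrow)$ from $\vdash V:A\mid\Gamma$ infer $\vdash\{V\}:{\downarrow}A\mid\Gamma$; $(\uparrow)$ from $c:(\vdash\kappa:A,\Gamma)$ infer $\vdash\mu\{\kappa\}.c:{\uparrow}A\mid\Gamma$; $(\exists)$ from $\vdash t:A[T/x^\tau]\mid\Gamma$ with $T:\tau$ infer $\vdash t:\exists x^\tau.A\mid\Gamma$; $(\forall)$ from $\vdash V:A\mid\Gamma$ with $x^\tau$ not free in $\Gamma$ infer $\vdash V:\forall x^\tau.A\mid\Gamma$; $(\cong)$ from $c:(\vdash\kappa:A,\Gamma)$ and $A\cong B$ infer $c:(\vdash\kappa:B,\Gamma)$; $(W)$ from $c:(\vdash\Gamma)$ infer $c:(\vdash\kappa:A,\Gamma)$; together with contraction $(C)$: from $c:(\vdash\kappa_1:A,\kappa_2:A,\Gamma)$ infer $c[\kappa/\kappa_1,\kappa/\kappa_2]:(\vdash\kappa:A,\Gamma)$. **Realizability.** Let $\mathcal M_0=\{0\}$ be the trivial quantitative monoid. Let $\bot\!\!\!\bot$ be a non-quantitative pole, i.e. a set of closed commands such that $c\to_0c'$ and $c'\in\bot\!\!\!\bot$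 imply $c\in\bot\!\!\!\bot$ for closed $c$, and let $\bot\!\!\!\bot_0=\{(c,0)\mid c\in\bot\!\!\!\bot\}$. For a set $X$ of weighted closed terms of one polarity, $X^\bot$ is the set of the $(u,q)$, $u$ closed of the opposite polarity, with $(\langle t|u\rangle,p+q)\in\bot\!\!\!\bot_0$ for all $(t,p)\in X$; $\overline X=\{(t,q)\mid\exists p\le q,\ (t,p)\in X\}$. Let $X\otimes Y=\{((V,V'),p+q)\mid(V,p)\in X,(V',q)\in Y\}$ and ${\downarrow}X=\{(\{V\},p)\mid(V,p)\in X\}$. Let $\mathcal D^\oplus$ be a positive propositional domain: a nonempty collection of sets of weighted closed positive values, closed under unions and intersections of nonempty families and such that $X\otimes Y,\ {\downarrow}X\in\mathcal D^\oplus$ for $X,Y\in\mathcal D^\oplus\cup\{Z^\bot\mid Z\in\mathcal D^\oplus\}$. Kinds are interpreted by $\mathbb N$ for $\iota$, $\mathcal D^\oplus$ for $o^+$, the orthogonals $X^\bot$, $X\in\mathcal D^\oplus$ (each recorded together with its $X$, so that its orthogonal is $X$) for $o^-$, and full function spaces. For a total valuation $\rho$ (a value in $\llbracket\tau\rrbracket$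 for every variable $x^\tau$), constructors are interpreted with $(x^\tau)^\bot$ and $rec_\tau^\bot$ as the (pointwise) orthogonals of $x^\tau$ and of the recursor, and $\llbracket A\otimes B\rrbracket_\rho=\llbracket A\rrbracket_\rho\otimes\llbracket B\rrbracket_\rho$, $\llbracket{\downarrow}A\rrbracket_\rho={\downarrow}\llbracket A\rrbracket_\rho$, $\llbracket\exists x^\tau.P\rrbracket_\rho=\bigcup_v\llbracket P\rrbracket_{\rho[x\leftarrow v]}$, $\llbracket\forall x^\tau.P\rrbracket_\rho=\bigcap_v\llbracket P\rrbracket_{\rho[x\leftarrow v]}$ ($v\in\llbracket\tau\rrbracket$), and each of $A\parr B$, ${\uparrow}A$, $\forall x^\tau.N$, $\exists x^\tau.N$ as the orthogonal of the interpretation of its negation. A finite substitution $\sigma$ of weighted values for variables is adequate to $\Gamma[\rho]$ if its domain is the set of variables of $\Gamma$ and $\sigma(\kappa)\in\llbracket A^\bot\rrbracket_\rho$ for each $\kappa:A$ in $\Gamma$; $(t,p)[\sigma]$ substitutes the values in $t$ and adds their weights to $p$. The judgment $c:(\vdash\Gamma)$ is $p$-adequate if $(c,p)[\sigma]\in\bot\!\!\!\bot_0$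 for all total $\rho$ and all $\sigma$ adequate to $\Gamma[\rho]$; $\vdash t:B\mid\Gamma$ is $p$-adequate if, for all such $\rho,\sigma$, $(t,p)[\sigma]\in\llbracket B\rrbracket_\rho^{\bot\bot}$ and moreover $(t,p)[\sigma]\in\overline{\llbracket B\rrbracket_\rho}$ when $t$ is a value. A rule is $f$-adequate if, for each of its instances and all weights $p_i$, whenever the premises are $p_i$-adequate the conclusion is $f(p_1,\dots,p_n)$-adequate. **Theorem (adequacy for $\mathrm{PA}\omega$).** For every such $\bot\!\!\!\bot$ and $\mathcal D^\oplus$, every rule $R$ of $\mathrm{PA}\omega$ is $\mathfrak m_R$-adequate, where, with $p_\beta=0$: $\mathfrak m_{Ax_+}=\mathfrak m_{Ax_-}=0$; $\mathfrak m_{Cut}=\mathfrak m_\otimes=(x,y)\mapsto x+y$; $\mathfrak m_\parr=\mathfrak m_\uparrow=x\mapsto x+p_\beta$; and $\mathfrak m_R=x\mapsto x$ for the other rules, including contraction. -/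

import Mathlib

universe u v

namespace PAw

/-! ### Polarities, kinds and type constructors -/

/-- Polarities. -/
inductive Pol
  | pos
  | neg
  deriving DecidableEq

/-- The opposite polarity. -/
@[reducible] def Pol.opp : Pol → Pol
  | .pos => .neg
  | .neg => .pos

/-- Kinds: individuals, formulas of a given polarity, functions. -/
inductive Kind
  | ind : Kind
  | prop : Pol → Kind
  | arr : Kind → Kind → Kind
  deriving DecidableEq

/-- Involutive negation of kinds. -/
@[reducible] def Kind.neg : Kind → Kind
  | .ind => .ind
  | .prop p => .prop p.opp
  | .arr σ τ => .arr σ τ.neg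

/-- `σ.negIf false = σ` and `σ.negIf true = σ^⊥`. -/
@[reducible] def Kind.negIf : Bool → Kind → Kind
  | false, σ => σ
  | true, σ => σ.neg

theorem Pol.opp_opp : ∀ p : Pol, p.opp.opp = p
  | .pos => rfl
  | .neg => rfl

theorem Kind.neg_neg : ∀ σ : Kind, σ.neg.neg = σ
  | .ind => rfl
  | .prop p => congrArg Kind.prop p.opp_opp
  | .arr σ τ => congrArg (Kind.arr σ) τ.neg_neg

theorem Kind.neg_eq_negIf_not {σ τ : Kind} :
    ∀ {s : Bool}, σ = τ.negIf s → σ.neg = τ.negIf (!s)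
  | false, h => congrArg Kind.neg h
  | true, h => (congrArg Kind.neg h).trans τ.neg_neg

/-- The kind of the recursor `rec_τ`. -/
@[reducible] def Kind.recKind (τ : Kind) : Kind :=
  .arr τ (.arr (.arr .ind (.arr τ τ)) (.arr .ind τ))

/-- Higher-order variables of kind `τ` that can be used under binders of kinds `Θ`. There are
countably many named variables `free n` of every kind; the variables bound by the surrounding
binders are de Bruijn indices, so that equality of syntax is `α`-equivalence. -/
inductive TVar : List Kind → Kind → Type
  | free {τ : Kind} (n : ℕ) : TVar [] τ
  | here {Θ : List Kind} {τ : Kind} : TVar (τ :: Θ) τ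
  | there {Θ : List Kind} {τ τ' : Kind} (x : TVar Θ τ) : TVar (τ' :: Θ) τ

/-- Well-formed type constructors of kind `σ` under binders of kinds `Θ`.
`var τ false _ x` is the variable `x^τ` and `var τ true _ x` is the dual variable `(x^τ)^⊥`, of kind
`τ^⊥`; likewise `recr τ false _` is `rec_τ` and `recr τ true _` is `rec_τ^⊥`. The kind is given up to
a propositional equality. -/
inductive Con : List Kind → Kind → Type
  | var {Θ : List Kind} {σ : Kind} (τ : Kind) (s : Bool) (h : σ = τ.negIf s) (x : TVar Θ τ) : Con Θ σ
  | lam {Θ : List Kind} (σ : Kind) {τ : Kind} (T : Con (σ :: Θ) τ) : Con Θ (.arr σ τ)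
  | app {Θ : List Kind} {σ τ : Kind} (T : Con Θ (.arr σ τ)) (U : Con Θ σ) : Con Θ τ
  | zero {Θ : List Kind} : Con Θ .ind
  | succ {Θ : List Kind} : Con Θ (.arr .ind .ind)
  | recr {Θ : List Kind} {σ : Kind} (τ : Kind) (s : Bool) (h : σ = τ.recKind.negIf s) : Con Θ σ
  | tensor {Θ : List Kind} {p q : Pol} (A : Con Θ (.prop p)) (B : Con Θ (.prop q)) :
      Con Θ (.prop .pos)
  | par {Θ : List Kind} {p q : Pol} (A : Con Θ (.prop p)) (B : Con Θ (.prop q)) :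
      Con Θ (.prop .neg)
  | ex {Θ : List Kind} (τ : Kind) {p : Pol} (A : Con (τ :: Θ) (.prop p)) : Con Θ (.prop p)
  | all {Θ : List Kind} (τ : Kind) {p : Pol} (A : Con (τ :: Θ) (.prop p)) : Con Θ (.prop p)
  | down {Θ : List Kind} {p : Pol} (A : Con Θ (.prop p)) : Con Θ (.prop .pos)
  | up {Θ : List Kind} {p : Pol} (A : Con Θ (.prop p)) : Con Θ (.prop .neg)

/-- Formulas of polarity `p`; their free variables are named variables. -/
abbrev Fm (p : Pol) : Type := Con [] (.prop p)

namespace Con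

/-- Involutive negation of constructors. -/
def neg : {Θ : List Kind} → {σ : Kind} → Con Θ σ → Con Θ σ.neg
  | _, _, .var τ s h x => .var τ (!s) (Kind.neg_eq_negIf_not h) x
  | _, _, .lam σ T => .lam σ T.neg
  | _, _, .app T U => .app T.neg U
  | _, _, .zero => .zero
  | _, _, .succ => .succ
  | _, _, .recr τ s h => .recr τ (!s) (Kind.neg_eq_negIf_not h)
  | _, _, .tensor A B => .par A.neg B.neg
  | _, _, .par A B => .tensor A.neg B.neg
  | _, _, .ex τ A => .all τ A.neg
  | _, _, .all τ A => .ex τ A.neg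
  | _, _, .down A => .up A.neg
  | _, _, .up A => .down A.neg

/-- `T.negIf false = T` and `T.negIf true = T^⊥`. -/
def negIf {Θ : List Kind} {σ : Kind} : (s : Bool) → Con Θ σ → Con Θ (σ.negIf s)
  | false, T => T
  | true, T => T.neg

/-- The action of a renaming under a binder. -/
def liftRen {Θ Θ' : List Kind} (r : (τ : Kind) → TVar Θ τ → TVar Θ' τ) (σ : Kind) :
    (τ : Kind) → TVar (σ :: Θ) τ → TVar (σ :: Θ') τ
  | _, .here => .here
  | _, .there x => .there (r _ x)

/-- Renaming of variables. -/
def ren : {Θ Θ' : List Kind} → {σ : Kind} → ((τ : Kind) → TVar Θ τ → TVar Θ' τ) →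
    Con Θ σ → Con Θ' σ
  | _, _, _, r, .var τ s h x => .var τ s h (r τ x)
  | _, _, _, r, .lam σ T => .lam σ (T.ren (liftRen r σ))
  | _, _, _, r, .app T U => .app (T.ren r) (U.ren r)
  | _, _, _, _, .zero => .zero
  | _, _, _, _, .succ => .succ
  | _, _, _, _, .recr τ s h => .recr τ s h
  | _, _, _, r, .tensor A B => .tensor (A.ren r) (B.ren r)
  | _, _, _, r, .par A B => .par (A.ren r) (B.ren r)
  | _, _, _, r, .ex τ A => .ex τ (A.ren (liftRen r τ))
  | _, _, _, r, .all τ A => .all τ (A.ren (liftRen r τ))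
  | _, _, _, r, .down A => .down (A.ren r)
  | _, _, _, r, .up A => .up (A.ren r)

/-- Weakening: the constructor `T` seen under one more binder. -/
def wk {Θ : List Kind} {σ : Kind} (τ : Kind) (T : Con Θ σ) : Con (τ :: Θ) σ :=
  T.ren (fun _ x => .there x)

/-- The action of a substitution under a binder. -/
def liftSub {Θ Θ' : List Kind} (θ : (τ : Kind) → TVar Θ τ → Con Θ' τ) (σ : Kind) :
    (τ : Kind) → TVar (σ :: Θ) τ → Con (σ :: Θ') τ
  | _, .here => .var _ false rfl .here
  | _, .there x => (θ _ x).wk σ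

/-- Simultaneous capture-avoiding substitution; `(x^τ)^⊥` is replaced by the negation of what
replaces `x^τ`. -/
def sub : {Θ Θ' : List Kind} → {σ : Kind} → ((τ : Kind) → TVar Θ τ → Con Θ' τ) →
    Con Θ σ → Con Θ' σ
  | _, _, _, θ, .var τ s h x => h ▸ (θ τ x).negIf s
  | _, _, _, θ, .lam σ T => .lam σ (T.sub (liftSub θ σ))
  | _, _, _, θ, .app T U => .app (T.sub θ) (U.sub θ)
  | _, _, _, _, .zero => .zero
  | _, _, _, _, .succ => .succ
  | _, _, _, _, .recr τ s h => .recr τ s h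
  | _, _, _, θ, .tensor A B => .tensor (A.sub θ) (B.sub θ)
  | _, _, _, θ, .par A B => .par (A.sub θ) (B.sub θ)
  | _, _, _, θ, .ex τ A => .ex τ (A.sub (liftSub θ τ))
  | _, _, _, θ, .all τ A => .all τ (A.sub (liftSub θ τ))
  | _, _, _, θ, .down A => .down (A.sub θ)
  | _, _, _, θ, .up A => .up (A.sub θ)

/-- The substitution that replaces the last bound variable by `U`. -/
def instSub {Θ : List Kind} {σ : Kind} (U : Con Θ σ) : (τ : Kind) → TVar (σ :: Θ) τ → Con Θ τ
  | _, .here => U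
  | _, .there x => .var _ false rfl x

/-- `T{x := U}`, where `x` is the last bound variable. -/
def inst {Θ : List Kind} {σ τ : Kind} (T : Con (σ :: Θ) τ) (U : Con Θ σ) : Con Θ τ :=
  T.sub (instSub U)

/-- Turning the named variable number `n` of kind `τ` into a bound variable. -/
def absVar (τ : Kind) (n : ℕ) : (τ' : Kind) → TVar [] τ' → TVar [τ] τ'
  | τ', .free m => if h : τ = τ' ∧ n = m then h.1 ▸ .here else .there (.free m)

/-- The body of a binder `λ x^τ. T`, `∀ x^τ. T` or `∃ x^τ. T`, where `x^τ` is the named variable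
number `n` of kind `τ`. -/
def abs (τ : Kind) (n : ℕ) {σ : Kind} (T : Con [] σ) : Con [τ] σ := T.ren (absVar τ n)

/-- `A[T/x^τ]`, where `x^τ` is the named variable number `n` of kind `τ`. -/
def subst (τ : Kind) (n : ℕ) {σ : Kind} (A : Con [] σ) (T : Con [] τ) : Con [] σ :=
  (A.abs τ n).inst T

/-- The named variable number `n` of kind `τ` is this variable. -/
def _root_.PAw.TVar.Is (τ : Kind) (n : ℕ) : {Θ : List Kind} → {τ' : Kind} → TVar Θ τ' → Prop
  | _, τ', .free m => τ = τ' ∧ n = m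
  | _, _, .here => False
  | _, _, .there x => x.Is τ n

/-- The named variable number `n` of kind `τ` occurs freely in a constructor. -/
def Occurs (τ : Kind) (n : ℕ) : {Θ : List Kind} → {σ : Kind} → Con Θ σ → Prop
  | _, _, .var _ _ _ x => x.Is τ n
  | _, _, .lam _ T => T.Occurs τ n
  | _, _, .app T U => T.Occurs τ n ∨ U.Occurs τ n
  | _, _, .zero => False
  | _, _, .succ => False
  | _, _, .recr _ _ _ => False
  | _, _, .tensor A B => A.Occurs τ n ∨ B.Occurs τ n
  | _, _, .par A B => A.Occurs τ n ∨ B.Occurs τ n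
  | _, _, .ex _ A => A.Occurs τ n
  | _, _, .all _ A => A.Occurs τ n
  | _, _, .down A => A.Occurs τ n
  | _, _, .up A => A.Occurs τ n

/-- The recursor `rec_τ` applied to three arguments. -/
def rec3 {Θ : List Kind} {τ : Kind} (T : Con Θ τ) (U : Con Θ (.arr .ind (.arr τ τ)))
    (n : Con Θ .ind) : Con Θ τ :=
  .app (.app (.app (.recr (σ := τ.recKind) τ false rfl) T) U) n

/-- The dual recursor `rec_τ^⊥` applied to three arguments. -/
def rec3Dual {Θ : List Kind} {τ : Kind} (T : Con Θ τ) (U : Con Θ (.arr .ind (.arr τ τ)))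
    (n : Con Θ .ind) : Con Θ τ.neg :=
  .app (.app (.app (.recr (σ := τ.recKind.neg) τ true rfl) T) U) n

end Con

/-- Convertibility of well-formed constructors. -/
inductive Conv : {Θ : List Kind} → {σ : Kind} → Con Θ σ → Con Θ σ → Prop
  | beta {Θ : List Kind} {σ τ : Kind} (T : Con (σ :: Θ) τ) (U : Con Θ σ) :
      Conv (.app (.lam σ T) U) (T.inst U)
  | eta {Θ : List Kind} {σ τ : Kind} (T : Con Θ (.arr σ τ)) :
      Conv (.lam σ (.app (T.wk σ) (.var σ false rfl .here))) T
  | rec_zero {Θ : List Kind} {τ : Kind} (T : Con Θ τ) (U : Con Θ (.arr .ind (.arr τ τ))) :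
      Conv (Con.rec3 T U .zero) T
  | rec_succ {Θ : List Kind} {τ : Kind} (T : Con Θ τ) (U : Con Θ (.arr .ind (.arr τ τ)))
      (n : Con Θ .ind) :
      Conv (Con.rec3 T U (.app .succ n)) (.app (.app U n) (Con.rec3 T U n))
  | recDual_zero {Θ : List Kind} {τ : Kind} (T : Con Θ τ) (U : Con Θ (.arr .ind (.arr τ τ))) :
      Conv (Con.rec3Dual T U .zero) T.neg
  | recDual_succ {Θ : List Kind} {τ : Kind} (T : Con Θ τ) (U : Con Θ (.arr .ind (.arr τ τ)))
      (n : Con Θ .ind) :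
      Conv (Con.rec3Dual T U (.app .succ n)) (.app (.app U.neg n) (Con.rec3 T U n))
  | refl {Θ : List Kind} {σ : Kind} (T : Con Θ σ) : Conv T T
  | symm {Θ : List Kind} {σ : Kind} {T T' : Con Θ σ} : Conv T T' → Conv T' T
  | trans {Θ : List Kind} {σ : Kind} {T T' T'' : Con Θ σ} : Conv T T' → Conv T' T'' → Conv T T''
  | lam {Θ : List Kind} {σ τ : Kind} {T T' : Con (σ :: Θ) τ} :
      Conv T T' → Conv (.lam σ T) (.lam σ T')
  | app {Θ : List Kind} {σ τ : Kind} {T T' : Con Θ (.arr σ τ)} {U U' : Con Θ σ} :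
      Conv T T' → Conv U U' → Conv (.app T U) (.app T' U')
  | tensor {Θ : List Kind} {p q : Pol} {A A' : Con Θ (.prop p)} {B B' : Con Θ (.prop q)} :
      Conv A A' → Conv B B' → Conv (.tensor A B) (.tensor A' B')
  | par {Θ : List Kind} {p q : Pol} {A A' : Con Θ (.prop p)} {B B' : Con Θ (.prop q)} :
      Conv A A' → Conv B B' → Conv (.par A B) (.par A' B')
  | ex {Θ : List Kind} {τ : Kind} {p : Pol} {A A' : Con (τ :: Θ) (.prop p)} :
      Conv A A' → Conv (.ex τ A) (.ex τ A')
  | all {Θ : List Kind} {τ : Kind} {p : Pol} {A A' : Con (τ :: Θ) (.prop p)} :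
      Conv A A' → Conv (.all τ A) (.all τ A')
  | down {Θ : List Kind} {p : Pol} {A A' : Con Θ (.prop p)} :
      Conv A A' → Conv (.down A) (.down A')
  | up {Θ : List Kind} {p : Pol} {A A' : Con Θ (.prop p)} :
      Conv A A' → Conv (.up A) (.up A')

/-! ### Values, terms and commands of the focalising system L -/

/-- Term variables of polarity `p` that can be used under binders of polarities `b`. There are
countably many named variables `free n` of each polarity; variables bound by the surrounding binders
are de Bruijn indices. -/
inductive Var : List Pol → Pol → Type
  | free {p : Pol} (n : ℕ) : Var [] p
  | here {b : List Pol} {p : Pol} : Var (p :: b) p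
  | there {b : List Pol} {p q : Pol} (x : Var b p) : Var (q :: b) p

/-- Syntactic categories: values of polarity `p` (the negative values are exactly the negative
terms), positive terms, commands. -/
inductive Cat
  | val (p : Pol)
  | posTm
  | cmd

/-- The category of the terms of polarity `p`. -/
@[reducible] def Pol.tmCat : Pol → Cat
  | .pos => .posTm
  | .neg => .val .neg

/-- The syntax, with positive instructions `Kp` and negative instructions `Kn`. A command
has exactly one positive and one negative side, hence `⟨t|u⟩` and `⟨u|t⟩` are the same object. -/
inductive Syn (Kp Kn : Type u) : Cat → List Pol → Type u
  | var {b : List Pol} {p : Pol} (x : Var b p) : Syn Kp Kn (.val p) b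
  | pair {b : List Pol} {p q : Pol} (V : Syn Kp Kn (.val p) b) (V' : Syn Kp Kn (.val q) b) :
      Syn Kp Kn (.val .pos) b
  | box {b : List Pol} {p : Pol} (V : Syn Kp Kn (.val p) b) : Syn Kp Kn (.val .pos) b
  | kpos {b : List Pol} (k : Kp) : Syn Kp Kn (.val .pos) b
  | ofVal {b : List Pol} (V : Syn Kp Kn (.val .pos) b) : Syn Kp Kn .posTm b
  /-- `μ α. c` -/
  | muNeg {b : List Pol} (c : Syn Kp Kn .cmd (.neg :: b)) : Syn Kp Kn .posTm b
  /-- `μ (κ, κ'). c` -/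
  | muPair {b : List Pol} (p q : Pol) (c : Syn Kp Kn .cmd (p :: q :: b)) : Syn Kp Kn (.val .neg) b
  /-- `μ {κ}. c` -/
  | muBox {b : List Pol} (p : Pol) (c : Syn Kp Kn .cmd (p :: b)) : Syn Kp Kn (.val .neg) b
  /-- `μ x. c` -/
  | muPos {b : List Pol} (c : Syn Kp Kn .cmd (.pos :: b)) : Syn Kp Kn (.val .neg) b
  | kneg {b : List Pol} (k : Kn) : Syn Kp Kn (.val .neg) b
  | cut {b : List Pol} (t : Syn Kp Kn .posTm b) (u : Syn Kp Kn (.val .neg) b) : Syn Kp Kn .cmd b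

/-- Names of term variables: a polarity and a number. -/
abbrev Name : Type := Pol × ℕ

/-- Values of polarity `p`. -/
abbrev Val (Kp Kn : Type u) (p : Pol) : Type u := Syn Kp Kn (.val p) []

/-- Terms of polarity `p`. -/
abbrev Tm (Kp Kn : Type u) (p : Pol) : Type u := Syn Kp Kn p.tmCat []

/-- Commands. -/
abbrev Cmd (Kp Kn : Type u) : Type u := Syn Kp Kn .cmd []

section Terms

variable {Kp Kn : Type u}

namespace Syn

/-- The action of a renaming under a binder. -/
def liftRen {b b' : List Pol} (r : (p : Pol) → Var b p → Var b' p) (q : Pol) :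
    (p : Pol) → Var (q :: b) p → Var (q :: b') p
  | _, .here => .here
  | _, .there x => .there (r _ x)

/-- Renaming of variables. -/
def ren : {k : Cat} → {b b' : List Pol} → ((p : Pol) → Var b p → Var b' p) →
    Syn Kp Kn k b → Syn Kp Kn k b'
  | _, _, _, r, .var x => .var (r _ x)
  | _, _, _, r, .pair V V' => .pair (V.ren r) (V'.ren r)
  | _, _, _, r, .box V => .box (V.ren r)
  | _, _, _, _, .kpos k => .kpos k
  | _, _, _, r, .ofVal V => .ofVal (V.ren r)
  | _, _, _, r, .muNeg c => .muNeg (c.ren (liftRen r _))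
  | _, _, _, r, .muPair p q c => .muPair p q (c.ren (liftRen (liftRen r q) p))
  | _, _, _, r, .muBox p c => .muBox p (c.ren (liftRen r p))
  | _, _, _, r, .muPos c => .muPos (c.ren (liftRen r _))
  | _, _, _, _, .kneg k => .kneg k
  | _, _, _, r, .cut t u => .cut (t.ren r) (u.ren r)

/-- The action of a substitution under a binder. -/
def liftSub {b b' : List Pol} (θ : (p : Pol) → Var b p → Syn Kp Kn (.val p) b') (q : Pol) :
    (p : Pol) → Var (q :: b) p → Syn Kp Kn (.val p) (q :: b')
  | _, .here => .var .here
  | _, .there x => (θ _ x).ren (fun _ y => .there y)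

/-- Simultaneous capture-avoiding substitution of values for variables. -/
def sub : {k : Cat} → {b b' : List Pol} → ((p : Pol) → Var b p → Syn Kp Kn (.val p) b') →
    Syn Kp Kn k b → Syn Kp Kn k b'
  | _, _, _, θ, .var x => θ _ x
  | _, _, _, θ, .pair V V' => .pair (V.sub θ) (V'.sub θ)
  | _, _, _, θ, .box V => .box (V.sub θ)
  | _, _, _, _, .kpos k => .kpos k
  | _, _, _, θ, .ofVal V => .ofVal (V.sub θ)
  | _, _, _, θ, .muNeg c => .muNeg (c.sub (liftSub θ _))
  | _, _, _, θ, .muPair p q c => .muPair p q (c.sub (liftSub (liftSub θ q) p))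
  | _, _, _, θ, .muBox p c => .muBox p (c.sub (liftSub θ p))
  | _, _, _, θ, .muPos c => .muPos (c.sub (liftSub θ _))
  | _, _, _, _, .kneg k => .kneg k
  | _, _, _, θ, .cut t u => .cut (t.sub θ) (u.sub θ)

/-- The substitution that replaces the last bound variable by `V`. -/
def instSub {p : Pol} (V : Val Kp Kn p) : (q : Pol) → Var [p] q → Val Kp Kn q
  | _, .here => V
  | _, .there x => .var x

/-- The substitution that replaces the last two bound variables by `V` and `V'`. -/
def instSub₂ {p p' : Pol} (V : Val Kp Kn p) (V' : Val Kp Kn p') :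
    (q : Pol) → Var [p, p'] q → Val Kp Kn q
  | _, .here => V
  | _, .there .here => V'
  | _, .there (.there x) => .var x

/-- `c[V/κ]` for the body `c` of a binder of `κ`. -/
def inst {p : Pol} (c : Syn Kp Kn .cmd [p]) (V : Val Kp Kn p) : Cmd Kp Kn := c.sub (instSub V)

/-- `c[V/κ, V'/κ']` for the body `c` of a binder of `(κ, κ')`. -/
def inst₂ {p p' : Pol} (c : Syn Kp Kn .cmd [p, p']) (V : Val Kp Kn p) (V' : Val Kp Kn p') :
    Cmd Kp Kn := c.sub (instSub₂ V V')

/-- Turning the named variable `n` of polarity `p` into a bound variable. -/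
def absVar (p : Pol) (n : ℕ) : (q : Pol) → Var [] q → Var [p] q
  | q, .free m => if h : p = q ∧ n = m then h.1 ▸ .here else .there (.free m)

/-- Turning two named variables into bound variables. -/
def absVar₂ (p : Pol) (n : ℕ) (p' : Pol) (n' : ℕ) : (q : Pol) → Var [] q → Var [p, p'] q
  | q, .free m =>
      if h : p = q ∧ n = m then h.1 ▸ .here
      else if h' : p' = q ∧ n' = m then h'.1 ▸ .there .here
      else .there (.there (.free m))

/-- The body of a binder of the named variable `n` of polarity `p`. -/
def abs (p : Pol) (n : ℕ) (c : Cmd Kp Kn) : Syn Kp Kn .cmd [p] := c.ren (absVar p n)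

/-- The body of a binder of the pair of the named variables `(p, n)` and `(p', n')`. -/
def abs₂ (p : Pol) (n : ℕ) (p' : Pol) (n' : ℕ) (c : Cmd Kp Kn) : Syn Kp Kn .cmd [p, p'] :=
  c.ren (absVar₂ p n p' n')

/-- Sending two named variables of polarity `p` to a third one. -/
def contrVar (p : Pol) (n₁ n₂ n : ℕ) : (q : Pol) → Var [] q → Var [] q
  | q, .free m => if p = q ∧ (m = n₁ ∨ m = n₂) then .free n else .free m

/-- `c[κ/κ₁, κ/κ₂]` for the named variables `n₁`, `n₂`, `n` of polarity `p`. -/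
def contr (p : Pol) (n₁ n₂ n : ℕ) (c : Cmd Kp Kn) : Cmd Kp Kn := c.ren (contrVar p n₁ n₂ n)

/-- The free name of a variable, if it is not bound. -/
def _root_.PAw.Var.fv : {b : List Pol} → {p : Pol} → Var b p → Finset Name
  | _, p, .free n => {(p, n)}
  | _, _, .here => ∅
  | _, _, .there x => x.fv

/-- Free (named) variables. -/
def fv : {k : Cat} → {b : List Pol} → Syn Kp Kn k b → Finset Name
  | _, _, .var x => x.fv
  | _, _, .pair V V' => V.fv ∪ V'.fv
  | _, _, .box V => V.fv
  | _, _, .kpos _ => ∅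
  | _, _, .ofVal V => V.fv
  | _, _, .muNeg c => c.fv
  | _, _, .muPair _ _ c => c.fv
  | _, _, .muBox _ c => c.fv
  | _, _, .muPos c => c.fv
  | _, _, .kneg _ => ∅
  | _, _, .cut t u => t.fv ∪ u.fv

/-- Closed syntax: no free variables. -/
def Closed {k : Cat} (t : Syn Kp Kn k []) : Prop := t.fv = ∅

/-- A value, seen as a term of the same polarity. -/
def toTm : {p : Pol} → Val Kp Kn p → Tm Kp Kn p
  | .pos, V => .ofVal V
  | .neg, t => t

/-- The term `t` is a value. -/
def IsValue {p : Pol} (t : Tm Kp Kn p) : Prop := ∃ V : Val Kp Kn p, t = V.toTm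

/-- The command `⟨t|u⟩ = ⟨u|t⟩` for terms of opposite polarities. -/
def com : {p : Pol} → Tm Kp Kn p → Tm Kp Kn p.opp → Cmd Kp Kn
  | .pos, t, u => .cut t u
  | .neg, t, u => .cut u t

end Syn

/-- The reductions `→_μ`. -/
inductive RedMu : Cmd Kp Kn → Cmd Kp Kn → Prop
  | pos (c : Syn Kp Kn .cmd [.neg]) (t : Val Kp Kn .neg) : RedMu (.cut (.muNeg c) t) (c.inst t)
  | neg (V : Val Kp Kn .pos) (c : Syn Kp Kn .cmd [.pos]) :
      RedMu (.cut (.ofVal V) (.muPos c)) (c.inst V)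

/-- The reductions `→_β`. -/
inductive RedBeta : Cmd Kp Kn → Cmd Kp Kn → Prop
  | up {p : Pol} (V : Val Kp Kn p) (c : Syn Kp Kn .cmd [p]) :
      RedBeta (.cut (.ofVal (.box V)) (.muBox p c)) (c.inst V)
  | par {p q : Pol} (V : Val Kp Kn p) (V' : Val Kp Kn q) (c : Syn Kp Kn .cmd [p, q]) :
      RedBeta (.cut (.ofVal (.pair V V')) (.muPair p q c)) (c.inst₂ V V')

/-- `→_0`, the union of `→_β` and `→_μ`. -/
def Red₀ (c c' : Cmd Kp Kn) : Prop := RedBeta c c' ∨ RedMu c c'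

end Terms

/-! ### Quantitative monoids, poles and orthogonality -/

/-- Quantitative monoids: preordered commutative monoids with a compatible anti-triangular norm. -/
class QuantMonoid (M : Type v) extends AddCommMonoid M, Preorder M where
  add_le_add_left' : ∀ p q r : M, p ≤ q → r + p ≤ r + q
  norm : M → ℕ
  norm_add : ∀ p q : M, norm p + norm q ≤ norm (p + q)
  norm_mono : ∀ p q : M, p ≤ q → norm p ≤ norm q

/-- The trivial quantitative monoid `{0}`. -/
instance trivialQuantMonoid : QuantMonoid Unit where
  add_le_add_left' _ _ _ _ := le_rfl
  norm _ := 0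
  norm_add _ _ := le_rfl
  norm_mono _ _ _ := le_rfl

/-- Quantitative poles: sets of weighted closed commands. -/
structure QPole (Kp Kn : Type u) (M : Type v) where
  carrier : Set (Cmd Kp Kn × M)
  closed : ∀ w ∈ carrier, w.1.Closed

/-- Non-quantitative poles: sets of closed commands that are closed under anti-evaluation. -/
structure SimplePole (Kp Kn : Type u) where
  carrier : Set (Cmd Kp Kn)
  closed : ∀ c ∈ carrier, c.Closed
  anti_eval : ∀ c c' : Cmd Kp Kn, c.Closed → Red₀ c c' → c' ∈ carrier → c ∈ carrier

/-- The quantitative extension `{(c, 0) | c ∈ ⫫}` of a non-quantitative pole. -/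
def SimplePole.quant {Kp Kn : Type u} (B : SimplePole Kp Kn) : QPole Kp Kn Unit where
  carrier := {w | w.1 ∈ B.carrier ∧ w.2 = 0}
  closed w hw := B.closed w.1 hw.1

/-- Sets of weighted terms of polarity `p`. -/
abbrev WSet (Kp Kn : Type u) (M : Type v) (p : Pol) : Type (max u v) := Set (Tm Kp Kn p × M)

section Semantics

variable {Kp Kn : Type u} {M : Type v} [QuantMonoid M]

/-- The orthogonal of a set of weighted terms, a set of weighted closed terms. -/
def QPole.orth (B : QPole Kp Kn M) {p : Pol} (X : WSet Kp Kn M p) : WSet Kp Kn M p.opp :=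
  {w | w.1.Closed ∧ ∀ x ∈ X, (Syn.com x.1 w.1, x.2 + w.2) ∈ B.carrier}

/-- The biorthogonal of a set of weighted terms. -/
def QPole.biorth (B : QPole Kp Kn M) : {p : Pol} → WSet Kp Kn M p → WSet Kp Kn M p
  | .pos, X => B.orth (B.orth X)
  | .neg, X => B.orth (B.orth X)

/-- The `≤`-closure `{(t, q) | ∃ p ≤ q, (t, p) ∈ X}`. -/
def upClosure {p : Pol} (X : WSet Kp Kn M p) : WSet Kp Kn M p :=
  {w | ∃ m ≤ w.2, (w.1, m) ∈ X}

/-- `X ⊗ Y = {((V, V'), m + m') | (V, m) ∈ X, (V', m') ∈ Y}`. -/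
def tensorSet {p q : Pol} (X : WSet Kp Kn M p) (Y : WSet Kp Kn M q) : WSet Kp Kn M .pos :=
  {w | ∃ (V : Val Kp Kn p) (m : M) (V' : Val Kp Kn q) (m' : M),
    (V.toTm, m) ∈ X ∧ (V'.toTm, m') ∈ Y ∧ w = (.ofVal (.pair V V'), m + m')}

/-- `↓X = {({V}, m) | (V, m) ∈ X}`. -/
def downSet {p : Pol} (X : WSet Kp Kn M p) : WSet Kp Kn M .pos :=
  {w | ∃ (V : Val Kp Kn p) (m : M), (V.toTm, m) ∈ X ∧ w = (.ofVal (.box V), m)}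

/-- Membership in `𝒟 = 𝒟⁺ ∪ 𝒟⁻`, where `𝒟⁻ = {X^⊥ | X ∈ 𝒟⁺}`. -/
def QPole.InDom (B : QPole Kp Kn M) (D : Set (WSet Kp Kn M .pos)) :
    (p : Pol) → WSet Kp Kn M p → Prop
  | .pos, X => X ∈ D
  | .neg, X => ∃ Y ∈ D, X = B.orth Y

/-- Positive propositional domains: nonempty collections of sets of weighted closed positive values
that are closed under unions and intersections of nonempty families, under `⊗` and under `↓`. -/
structure PropDomain (B : QPole Kp Kn M) where
  sets : Set (WSet Kp Kn M .pos)
  closed_value : ∀ X ∈ sets, ∀ w ∈ X, w.1.Closed ∧ Syn.IsValue w.1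
  nonempty : sets.Nonempty
  sUnion_mem : ∀ S ⊆ sets, S.Nonempty → ⋃₀ S ∈ sets
  sInter_mem : ∀ S ⊆ sets, S.Nonempty → ⋂₀ S ∈ sets
  tensor_mem : ∀ (p q : Pol) (X : WSet Kp Kn M p) (Y : WSet Kp Kn M q),
    B.InDom sets p X → B.InDom sets q Y → tensorSet X Y ∈ sets
  down_mem : ∀ (p : Pol) (X : WSet Kp Kn M p), B.InDom sets p X → downSet X ∈ sets

namespace PropDomain

variable {B : QPole Kp Kn M} (D : PropDomain B)

/-- Interpretation of the kind of negative formulas. Its elements are the orthogonals `X^⊥`,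
`X ∈ 𝒟⁺`; such an element is recorded together with the `X` it is the orthogonal of, which is what
`⊥(X^⊥, o⁻) = X` requires. -/
structure NegElem where
  pre : WSet Kp Kn M .pos
  mem : pre ∈ D.sets

/-- Interpretation of kinds. -/
def den : Kind → Type (max u v)
  | .ind => ULift.{max u v} ℕ
  | .prop .pos => {X : WSet Kp Kn M .pos // X ∈ D.sets}
  | .prop .neg => D.NegElem
  | .arr σ τ => den σ → den τ

theorem den_nonempty : ∀ σ : Kind, Nonempty (D.den σ)
  | .ind => ⟨ULift.up 0⟩
  | .prop .pos => D.nonempty.elim fun X hX => ⟨⟨X, hX⟩⟩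
  | .prop .neg => D.nonempty.elim fun X hX => ⟨⟨X, hX⟩⟩
  | .arr _ τ => (den_nonempty τ).elim fun t => ⟨fun _ => t⟩

/-- The set of weighted terms given by an element of the interpretation of a kind of formulas. -/
def toSet : {p : Pol} → D.den (.prop p) → WSet Kp Kn M p
  | .pos, X => X.1
  | .neg, X => B.orth (NegElem.pre X)

theorem inDom_toSet : ∀ {p : Pol} (X : D.den (.prop p)), B.InDom D.sets p (D.toSet X)
  | .pos, X => X.2
  | .neg, X => ⟨X.pre, X.mem, rfl⟩

/-- Orthogonality `⊥(·, σ)` on the elements of the interpretation of any kind `σ`. -/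
def perp : (σ : Kind) → D.den σ → D.den σ.neg
  | .ind, n => n
  | .prop .pos, X => NegElem.mk X.1 X.2
  | .prop .neg, X => ⟨NegElem.pre X, NegElem.mem X⟩
  | .arr _ τ, f => fun v => perp τ (f v)

/-- `⊥(·, σ)` or the identity. -/
def perpIf : (s : Bool) → (σ : Kind) → D.den σ → D.den (σ.negIf s)
  | false, _, v => v
  | true, σ, v => D.perp σ v

/-- Union of a family of elements of `𝒟⁺`. -/
def unionPos {ι : Type*} (h : Nonempty ι) (F : ι → D.den (.prop .pos)) : D.den (.prop .pos) :=
  ⟨⋃₀ Set.range fun i => D.toSet (F i),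
    D.sUnion_mem _ (Set.range_subset_iff.2 fun i => D.inDom_toSet (F i)) (Set.range_nonempty _)⟩

/-- Intersection of a family of elements of `𝒟⁺`. -/
def interPos {ι : Type*} (h : Nonempty ι) (F : ι → D.den (.prop .pos)) : D.den (.prop .pos) :=
  ⟨⋂₀ Set.range fun i => D.toSet (F i),
    D.sInter_mem _ (Set.range_subset_iff.2 fun i => D.inDom_toSet (F i)) (Set.range_nonempty _)⟩

/-- Interpretation of `∃`: the union for positive formulas, and the orthogonal of the intersection of
the orthogonals for negative formulas. -/
def semEx {ι : Type*} (h : Nonempty ι) : {p : Pol} → (ι → D.den (.prop p)) → D.den (.prop p)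
  | .pos, F => D.unionPos h F
  | .neg, F => D.perp (.prop .pos) (D.interPos h fun i => D.perp (.prop .neg) (F i))

/-- Interpretation of `∀`: the intersection for positive formulas, and the orthogonal of the union of
the orthogonals for negative formulas. -/
def semAll {ι : Type*} (h : Nonempty ι) : {p : Pol} → (ι → D.den (.prop p)) → D.den (.prop p)
  | .pos, F => D.interPos h F
  | .neg, F => D.perp (.prop .pos) (D.unionPos h fun i => D.perp (.prop .neg) (F i))

/-- Interpretation of `⊗`. -/
def semTensor {p q : Pol} (X : D.den (.prop p)) (Y : D.den (.prop q)) : D.den (.prop .pos) :=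
  ⟨tensorSet (D.toSet X) (D.toSet Y), D.tensor_mem _ _ _ _ (D.inDom_toSet X) (D.inDom_toSet Y)⟩

/-- Interpretation of `↓`. -/
def semDown {p : Pol} (X : D.den (.prop p)) : D.den (.prop .pos) :=
  ⟨downSet (D.toSet X), D.down_mem _ _ (D.inDom_toSet X)⟩

/-- Interpretation of the recursor. -/
def semRec (τ : Kind) : D.den τ.recKind :=
  fun (t : D.den τ) (f : ULift.{max u v} ℕ → D.den τ → D.den τ) (n : ULift.{max u v} ℕ) =>
    Nat.rec (motive := fun _ => D.den τ) t (fun k r => f (ULift.up k) r) n.down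

/-- Values for all the variables that can be used under binders of kinds `Θ`. -/
abbrev Env (Θ : List Kind) : Type (max u v) := (τ : Kind) → TVar Θ τ → D.den τ

/-- The extension of an environment by a value for the last bound variable. -/
def Env.cons {D : PropDomain B} {Θ : List Kind} {σ : Kind} (ρ : D.Env Θ) (v : D.den σ) :
    D.Env (σ :: Θ)
  | _, .here => v
  | _, .there x => ρ _ x

/-- Interpretation of constructors. -/
def interp : {Θ : List Kind} → {σ : Kind} → D.Env Θ → Con Θ σ → D.den σ
  | _, _, ρ, .var τ s h x => h ▸ D.perpIf s τ (ρ τ x)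
  | _, _, ρ, .lam _ T => fun v => interp (ρ.cons v) T
  | _, _, ρ, .app T U => (interp ρ T) (interp ρ U)
  | _, _, _, .zero => ULift.up 0
  | _, _, _, .succ => fun n : ULift.{max u v} ℕ => ULift.up (n.down + 1)
  | _, _, _, .recr τ s h => h ▸ D.perpIf s _ (D.semRec τ)
  | _, _, ρ, .tensor A B => D.semTensor (interp ρ A) (interp ρ B)
  | _, _, ρ, .par A B => D.perp (.prop .pos)
      (D.semTensor (D.perp _ (interp ρ A)) (D.perp _ (interp ρ B)))
  | _, _, ρ, .ex τ A => D.semEx (D.den_nonempty τ) fun v => interp (ρ.cons v) A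
  | _, _, ρ, .all τ A => D.semAll (D.den_nonempty τ) fun v => interp (ρ.cons v) A
  | _, _, ρ, .down A => D.semDown (interp ρ A)
  | _, _, ρ, .up A => D.perp (.prop .pos) (D.semDown (D.perp _ (interp ρ A)))

theorem perp_perp : ∀ (σ : Kind) (v : D.den σ), HEq (D.perp σ.neg (D.perp σ v)) v
  | .ind, _ => HEq.rfl
  | .prop .pos, _ => HEq.rfl
  | .prop .neg, _ => HEq.rfl
  | .arr σ τ, f => by
      have h := fun v => perp_perp τ (f v)
      have hk : D.den τ.neg.neg = D.den τ := by rw [Kind.neg_neg]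
      change HEq (fun v => D.perp τ.neg (D.perp τ (f v))) f
      exact Function.hfunext rfl (fun a a' ha => by cases ha; exact h a)

theorem atom_neg {τ σ : Kind} (s : Bool) (h : σ = τ.negIf s) (h' : σ.neg = τ.negIf (!s))
    (v : D.den τ) : (h' ▸ D.perpIf (!s) τ v : D.den σ.neg) = D.perp σ (h ▸ D.perpIf s τ v) := by
  cases s with
  | false =>
    change σ = τ at h
    subst h; rfl
  | true =>
    change σ = τ.neg at h
    subst h
    change (h' ▸ v : D.den τ.neg.neg) = D.perp τ.neg (D.perp τ v)
    apply eq_of_heq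
    refine HEq.trans ?_ (perp_perp D τ v).symm
    exact eqRec_heq _ _

/-- The interpretation of `T^⊥` is `⊥(⟦T⟧, σ)`. In particular the clauses for `⅋`, `↑`, `∀` and `∃` above,
which are written with `⊥(⟦A⟧, ·)`, are the clauses written with `⟦A^⊥⟧`. -/
theorem interp_neg : ∀ {Θ : List Kind} {σ : Kind} (ρ : D.Env Θ) (T : Con Θ σ),
    D.interp ρ T.neg = D.perp σ (D.interp ρ T)
  | _, _, ρ, .var τ s h x => atom_neg D s h (Kind.neg_eq_negIf_not h) _
  | _, _, ρ, .lam _ T => funext fun v => interp_neg (ρ.cons v) T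
  | _, _, ρ, .app T U => congrFun (interp_neg ρ T) (D.interp ρ U)
  | _, _, _, .zero => rfl
  | _, _, _, .succ => rfl
  | _, _, _, .recr τ s h => atom_neg D s h (Kind.neg_eq_negIf_not h) _
  | _, _, ρ, .tensor (p := p) (q := q) A C => by
      have a := interp_neg ρ A; have b := interp_neg ρ C
      cases p <;> cases q <;>
      exact congrArg₂ (fun X Y => D.perp (.prop .pos)
        (D.semTensor (D.perp (.prop _) X) (D.perp (.prop _) Y))) a b
  | _, _, ρ, .par A C =>
      congrArg₂ (fun X Y => D.semTensor X Y) (interp_neg ρ A) (interp_neg ρ C)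
  | _, _, ρ, .ex (p := p) τ A => by
      have a := funext fun v => interp_neg (ρ.cons v) A
      cases p <;> exact congrArg (fun F => D.semAll (D.den_nonempty τ) F) a
  | _, _, ρ, .all (p := p) τ A => by
      have a := funext fun v => interp_neg (ρ.cons v) A
      cases p <;> exact congrArg (fun F => D.semEx (D.den_nonempty τ) F) a
  | _, _, ρ, .down (p := p) A => by
      have a := interp_neg ρ A
      cases p <;>
      exact congrArg (fun X => D.perp (.prop .pos) (D.semDown (D.perp (.prop _) X))) a
  | _, _, ρ, .up A => congrArg (fun X => D.semDown X) (interp_neg ρ A)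

/-- Total valuations: a value for every named variable of every kind. -/
abbrev Valuation : Type (max u v) := (τ : Kind) → ℕ → D.den τ

/-- A total valuation, seen as an environment. -/
def Valuation.toEnv {D : PropDomain B} (ρ : D.Valuation) : D.Env []
  | _, .free n => ρ _ n

/-- The set of weighted values that interprets a formula under a total valuation. -/
def interpFm (ρ : D.Valuation) {p : Pol} (A : Fm p) : WSet Kp Kn M p :=
  D.toSet (D.interp ρ.toEnv A)

end PropDomain

end Semantics

/-! ### Typing judgments and rules -/

/-- A declaration `κ : A`. The polarity of the variable `κ` is opposite to the one of `A`. -/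
structure Decl where
  pol : Pol
  idx : ℕ
  ty : Fm pol

/-- The declared variable. -/
def Decl.name (d : Decl) : Name := (d.pol.opp, d.idx)

noncomputable instance : DecidableEq Decl := Classical.decEq _

/-- Typing contexts: finite sets of declarations. -/
abbrev Ctx : Type := Finset Decl

/-- The declared variables of a context. -/
def Ctx.dom (Γ : Ctx) : Finset Name := Finset.image Decl.name Γ

/-- The higher-order variable number `n` of kind `τ` occurs freely in a context. -/
def Ctx.Occurs (τ : Kind) (n : ℕ) (Γ : Ctx) : Prop := ∃ d ∈ Γ, d.ty.Occurs τ n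

/-- Typing judgments `c : (⊢ Γ)` and `⊢ t : B | Γ`. -/
inductive Judgment (Kp Kn : Type u) : Type u
  | cmd (c : Cmd Kp Kn) (Γ : Ctx)
  | tm (p : Pol) (t : Tm Kp Kn p) (B : Fm p) (Γ : Ctx)

/-- The free variables of the subject of the judgment are declared in its context. -/
def Judgment.Scoped {Kp Kn : Type u} : Judgment Kp Kn → Prop
  | .cmd c Γ => c.fv ⊆ Γ.dom
  | .tm _ t _ Γ => t.fv ⊆ Γ.dom

/-- The rules of higher-order classical Peano arithmetic: those of its multiplicative affine
fragment, and contraction. -/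
inductive Rule
  | axPos | axNeg | muPos | muNeg | cut | tensor | par | down | up | ex | all | conv | weak | contr

/-- The number of premises of a rule. -/
def Rule.arity : Rule → ℕ
  | .axPos => 0
  | .axNeg => 0
  | .muPos => 1
  | .muNeg => 1
  | .cut => 2
  | .tensor => 2
  | .par => 1
  | .down => 1
  | .up => 1
  | .ex => 1
  | .all => 1
  | .conv => 1
  | .weak => 1
  | .contr => 1

/-- The instances of the rules, given by their premises and their conclusion. In `κ : A, Γ`
the variable `κ` is not declared in `Γ`, and in `Γ, Δ` no variable is declared both in `Γ` and in
`Δ`. -/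
inductive Rule.Inst {Kp Kn : Type u} :
    (R : Rule) → (Fin R.arity → Judgment Kp Kn) → Judgment Kp Kn → Prop
  | axPos (n : ℕ) (P : Fm .pos) :
      Inst .axPos ![] (.tm .pos (.ofVal (.var (.free n))) P {⟨.neg, n, P.neg⟩})
  | axNeg (n : ℕ) (N : Fm .neg) :
      Inst .axNeg ![] (.tm .neg (.var (.free n)) N {⟨.pos, n, N.neg⟩})
  | muPos (c : Cmd Kp Kn) (n : ℕ) (P : Fm .pos) (Γ : Ctx) (hn : (Pol.neg, n) ∉ Γ.dom) :
      Inst .muPos ![.cmd c (insert ⟨.pos, n, P⟩ Γ)]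
        (.tm .pos (.muNeg (c.abs .neg n)) P Γ)
  | muNeg (c : Cmd Kp Kn) (n : ℕ) (N : Fm .neg) (Γ : Ctx) (hn : (Pol.pos, n) ∉ Γ.dom) :
      Inst .muNeg ![.cmd c (insert ⟨.neg, n, N⟩ Γ)]
        (.tm .neg (.muPos (c.abs .pos n)) N Γ)
  | cut {p : Pol} (t : Tm Kp Kn p) (u : Tm Kp Kn p.opp) (A : Fm p) (Γ Δ : Ctx)
      (hd : Disjoint Γ.dom Δ.dom) :
      Inst .cut ![.tm p t A Γ, .tm p.opp u A.neg Δ] (.cmd (Syn.com t u) (Γ ∪ Δ))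
  | tensor {p q : Pol} (V : Val Kp Kn p) (V' : Val Kp Kn q) (A : Fm p) (A' : Fm q) (Γ Δ : Ctx)
      (hd : Disjoint Γ.dom Δ.dom) :
      Inst .tensor ![.tm p V.toTm A Γ, .tm q V'.toTm A' Δ]
        (.tm .pos (.ofVal (.pair V V')) (.tensor A A') (Γ ∪ Δ))
  | par {p q : Pol} (c : Cmd Kp Kn) (n n' : ℕ) (A : Fm p) (A' : Fm q) (Γ : Ctx)
      (hne : (p.opp, n) ≠ (q.opp, n')) (hn : (p.opp, n) ∉ Γ.dom) (hn' : (q.opp, n') ∉ Γ.dom) :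
      Inst .par ![.cmd c (insert ⟨p, n, A⟩ (insert ⟨q, n', A'⟩ Γ))]
        (.tm .neg (.muPair p.opp q.opp (c.abs₂ p.opp n q.opp n')) (.par A A') Γ)
  | down {p : Pol} (V : Val Kp Kn p) (A : Fm p) (Γ : Ctx) :
      Inst .down ![.tm p V.toTm A Γ] (.tm .pos (.ofVal (.box V)) (.down A) Γ)
  | up {p : Pol} (c : Cmd Kp Kn) (n : ℕ) (A : Fm p) (Γ : Ctx) (hn : (p.opp, n) ∉ Γ.dom) :
      Inst .up ![.cmd c (insert ⟨p, n, A⟩ Γ)]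
        (.tm .neg (.muBox p.opp (c.abs p.opp n)) (.up A) Γ)
  | ex {p : Pol} (t : Tm Kp Kn p) (τ : Kind) (x : ℕ) (A : Fm p) (T : Con [] τ) (Γ : Ctx) :
      Inst .ex ![.tm p t (A.subst τ x T) Γ] (.tm p t (.ex τ (A.abs τ x)) Γ)
  | all {p : Pol} (V : Val Kp Kn p) (τ : Kind) (x : ℕ) (A : Fm p) (Γ : Ctx)
      (hx : ¬ Γ.Occurs τ x) :
      Inst .all ![.tm p V.toTm A Γ] (.tm p V.toTm (.all τ (A.abs τ x)) Γ)
  | conv {p : Pol} (c : Cmd Kp Kn) (n : ℕ) (A A' : Fm p) (Γ : Ctx) (hn : (p.opp, n) ∉ Γ.dom)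
      (hA : Conv A A') :
      Inst .conv ![.cmd c (insert ⟨p, n, A⟩ Γ)] (.cmd c (insert ⟨p, n, A'⟩ Γ))
  | weak {p : Pol} (c : Cmd Kp Kn) (n : ℕ) (A : Fm p) (Γ : Ctx) (hn : (p.opp, n) ∉ Γ.dom) :
      Inst .weak ![.cmd c Γ] (.cmd c (insert ⟨p, n, A⟩ Γ))
  | contr {p : Pol} (c : Cmd Kp Kn) (n₁ n₂ n : ℕ) (A : Fm p) (Γ : Ctx) (hne : n₁ ≠ n₂)
      (hn₁ : (p.opp, n₁) ∉ Γ.dom) (hn₂ : (p.opp, n₂) ∉ Γ.dom) (hn : (p.opp, n) ∉ Γ.dom) :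
      Inst .contr ![.cmd c (insert ⟨p, n₁, A⟩ (insert ⟨p, n₂, A⟩ Γ))]
        (.cmd (c.contr p.opp n₁ n₂ n) (insert ⟨p, n, A⟩ Γ))

/-! ### Adequacy -/

section Adequacy

variable {Kp Kn : Type u} {M : Type v} [QuantMonoid M]

/-- Substitutions: finite partial maps from term variables to weighted values (of the polarity of the
variable). -/
structure Subst (Kp Kn : Type u) (M : Type v) where
  dom : Finset Name
  val : (x : Name) → x ∈ dom → Val Kp Kn x.1 × M

/-- The value that replaces a named variable. -/
def Subst.fn (σ : Subst Kp Kn M) : (p : Pol) → Var [] p → Val Kp Kn p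
  | p, .free n => if h : (p, n) ∈ σ.dom then (σ.val (p, n) h).1 else .var (.free n)

/-- The sum of the weights of a substitution. -/
def Subst.weight (σ : Subst Kp Kn M) : M := ∑ x ∈ σ.dom.attach, (σ.val x.1 x.2).2

/-- `(t, m)[σ]`, for a weighted term or command `(t, m)`. -/
def Subst.act (σ : Subst Kp Kn M) {k : Cat} (t : Syn Kp Kn k []) (m : M) : Syn Kp Kn k [] × M :=
  (t.sub σ.fn, m + σ.weight)

variable {B : QPole Kp Kn M}

/-- The substitution `σ` is adequate to `Γ[ρ]`. -/
def Subst.Adequate (σ : Subst Kp Kn M) (D : PropDomain B) (ρ : D.Valuation) (Γ : Ctx) : Prop :=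
  σ.dom = Γ.dom ∧ ∀ d ∈ Γ, ∀ h : d.name ∈ σ.dom,
    ((σ.val d.name h).1.toTm, (σ.val d.name h).2) ∈ D.interpFm ρ d.ty.neg

/-- `m`-adequate judgments. -/
def Judgment.Adequate (D : PropDomain B) (m : M) : Judgment Kp Kn → Prop
  | .cmd c Γ => ∀ (ρ : D.Valuation) (σ : Subst Kp Kn M), σ.Adequate D ρ Γ →
      σ.act c m ∈ B.carrier
  | .tm _ t A Γ => ∀ (ρ : D.Valuation) (σ : Subst Kp Kn M), σ.Adequate D ρ Γ →
      σ.act t m ∈ B.biorth (D.interpFm ρ A) ∧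
      (t.IsValue → σ.act t m ∈ upClosure (D.interpFm ρ A))

/-- `f`-adequate rules: whenever the premises `J i` of an instance are `m i`-adequate, the conclusion
is `f m`-adequate. Premises are judgments whose subject has all its free variables declared in the
context. -/
def Rule.Adequate (D : PropDomain B) (R : Rule) (f : (Fin R.arity → M) → M) : Prop :=
  ∀ (J : Fin R.arity → Judgment Kp Kn) (K : Judgment Kp Kn), R.Inst J K → (∀ i, (J i).Scoped) →
    ∀ m : Fin R.arity → M, (∀ i, (J i).Adequate D (m i)) → K.Adequate D (f m)

/-- The function on weights associated to a rule, where `pβ` is the cost of a `β`-reduction step. -/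
def Rule.cost (pβ : M) : (R : Rule) → (Fin R.arity → M) → M
  | .axPos, _ => 0
  | .axNeg, _ => 0
  | .muPos, m => m (0 : Fin 1)
  | .muNeg, m => m (0 : Fin 1)
  | .cut, m => m (0 : Fin 2) + m (1 : Fin 2)
  | .tensor, m => m (0 : Fin 2) + m (1 : Fin 2)
  | .par, m => m (0 : Fin 1) + pβ
  | .down, m => m (0 : Fin 1)
  | .up, m => m (0 : Fin 1) + pβ
  | .ex, m => m (0 : Fin 1)
  | .all, m => m (0 : Fin 1)
  | .conv, m => m (0 : Fin 1)
  | .weak, m => m (0 : Fin 1)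
  | .contr, m => m (0 : Fin 1)

end Adequacy

end PAw

namespace PAw

/-! ### Substitution and conversion in the interpretation of constructors -/

namespace PropDomain

variable {Kp Kn : Type u} {M : Type v} [QuantMonoid M] {B : QPole Kp Kn M} (D : PropDomain B)

/-! Each rule is checked on its own against the definition of orthogonality; no induction on
derivations is involved. Since the only weight is `()`, weights carry no information: the
`≤`-closure of a set is the set itself, and a scoped judgment is adequate exactly when every
assignment of realizers to its context sends the subject into the pole or, for a term, into the
biorthogonal of its type (into the type itself for a value). Contraction is harmless because using a
realizer twice costs nothing.

The logical content is that the interpretation of constructors commutes with substitution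
(`interp_sub`), hence is invariant under conversion (`interp_conv`), and turns negation into `perp`
(`interp_neg`). A negative element remembers the positive set it is the orthogonal of, so that on
formulas `perp` is an exact involution.

The computational content is `abs_sub_inst`: substituting under a binder and then instantiating the
body amounts to substituting with an updated assignment. A rule introducing a `μ` is adequate
because the new term, cut against a test, makes one `→₀` step to the premise under the updated
assignment, and the pole is closed under anti-evaluation. The redex must be closed, which follows
from the scoping of the premise.

Polarity decides the rest. Negative terms are values, and negative sets are orthogonals of sets of
positive values, so negative terms need only be tested against those values. In a cut the negative
side lies in the set itself and the positive side in a biorthogonal, so they are orthogonal. `∀`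
requires a value because a value lies in every instance of the type and not merely in its
biorthogonal; `∃` accepts any term because the biorthogonal is monotone. -/

theorem cons_liftRen {Θ Θ' : List Kind} {σ : Kind} (ρ : D.Env Θ') (v : D.den σ)
    (r : (τ : Kind) → TVar Θ τ → TVar Θ' τ) :
    (fun τ x => ρ.cons v τ (Con.liftRen r σ τ x)) = Env.cons (fun τ x => ρ τ (r τ x)) v := by
  funext τ x
  cases x <;> rfl

theorem interp_ren : ∀ {Θ Θ' : List Kind} {σ : Kind} (ρ : D.Env Θ')
    (r : (τ : Kind) → TVar Θ τ → TVar Θ' τ) (T : Con Θ σ),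
    D.interp ρ (T.ren r) = D.interp (fun τ x => ρ τ (r τ x)) T
  | _, _, _, _, _, .var _ _ _ _ => rfl
  | _, _, _, ρ, r, .lam σ T => funext fun v => by
      have h := interp_ren (ρ.cons v) (Con.liftRen r σ) T
      rw [cons_liftRen] at h
      exact h
  | _, _, _, ρ, r, .app T U => by
      simp only [Con.ren, interp, interp_ren ρ r T, interp_ren ρ r U]
  | _, _, _, _, _, .zero => rfl
  | _, _, _, _, _, .succ => rfl
  | _, _, _, _, _, .recr _ _ _ => rfl
  | _, _, _, ρ, r, .tensor T U => by
      simp only [Con.ren, interp, interp_ren ρ r T, interp_ren ρ r U]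
  | _, _, _, ρ, r, .par T U => by
      simp only [Con.ren, interp, interp_ren ρ r T, interp_ren ρ r U]
  | _, _, _, ρ, r, .ex τ A => by
      simp only [Con.ren, interp, interp_ren _ _ A, cons_liftRen]
  | _, _, _, ρ, r, .all τ A => by
      simp only [Con.ren, interp, interp_ren _ _ A, cons_liftRen]
  | _, _, _, ρ, r, .down A => by simp only [Con.ren, interp, interp_ren ρ r A]
  | _, _, _, ρ, r, .up A => by simp only [Con.ren, interp, interp_ren ρ r A]

theorem interp_wk {Θ : List Kind} {σ τ : Kind} (ρ : D.Env Θ) (v : D.den τ) (T : Con Θ σ) :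
    D.interp (ρ.cons v) (T.wk τ) = D.interp ρ T :=
  D.interp_ren _ _ T

theorem interp_negIf {Θ : List Kind} {σ : Kind} (ρ : D.Env Θ) (T : Con Θ σ) :
    ∀ s : Bool, D.interp ρ (T.negIf s) = D.perpIf s σ (D.interp ρ T)
  | false => rfl
  | true => D.interp_neg ρ T

theorem interp_liftSub {Θ Θ' : List Kind} {σ : Kind} (ρ : D.Env Θ') (v : D.den σ)
    (θ : (τ : Kind) → TVar Θ τ → Con Θ' τ) :
    (fun τ x => D.interp (ρ.cons v) (Con.liftSub θ σ τ x)) =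
      Env.cons (fun τ x => D.interp ρ (θ τ x)) v := by
  funext τ x
  cases x with
  | here => rfl
  | there x => exact D.interp_wk ρ v (θ τ x)

/-- The environment is general because binders extend it. Dual variables are where `interp_neg`
enters: substitution inserts a syntactic negation, while the interpretation applies `perp`. -/
theorem interp_sub : ∀ {Θ Θ' : List Kind} {σ : Kind} (ρ : D.Env Θ')
    (θ : (τ : Kind) → TVar Θ τ → Con Θ' τ) (T : Con Θ σ),
    D.interp ρ (T.sub θ) = D.interp (fun τ x => D.interp ρ (θ τ x)) T
  | _, _, _, ρ, θ, .var τ s h x => by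
      -- Once the kind is literally `τ.negIf s`, the transports along `h` in `sub` and `interp`
      -- disappear.
      subst h
      exact D.interp_negIf ρ (θ τ x) s
  | _, _, _, ρ, θ, .lam σ T => funext fun v => by
      have h := interp_sub (ρ.cons v) (Con.liftSub θ σ) T
      rw [interp_liftSub] at h
      exact h
  | _, _, _, ρ, θ, .app T U => by
      simp only [Con.sub, interp, interp_sub ρ θ T, interp_sub ρ θ U]
  | _, _, _, _, _, .zero => rfl
  | _, _, _, _, _, .succ => rfl
  | _, _, _, _, _, .recr _ _ _ => rfl
  | _, _, _, ρ, θ, .tensor T U => by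
      simp only [Con.sub, interp, interp_sub ρ θ T, interp_sub ρ θ U]
  | _, _, _, ρ, θ, .par T U => by
      simp only [Con.sub, interp, interp_sub ρ θ T, interp_sub ρ θ U]
  | _, _, _, ρ, θ, .ex τ A => by
      simp only [Con.sub, interp, interp_sub _ _ A, interp_liftSub]
  | _, _, _, ρ, θ, .all τ A => by
      simp only [Con.sub, interp, interp_sub _ _ A, interp_liftSub]
  | _, _, _, ρ, θ, .down A => by simp only [Con.sub, interp, interp_sub ρ θ A]
  | _, _, _, ρ, θ, .up A => by simp only [Con.sub, interp, interp_sub ρ θ A]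

theorem interp_inst {Θ : List Kind} {σ τ : Kind} (ρ : D.Env Θ) (T : Con (σ :: Θ) τ)
    (U : Con Θ σ) : D.interp ρ (T.inst U) = D.interp (ρ.cons (D.interp ρ U)) T := by
  rw [Con.inst, interp_sub]
  congr 1
  funext τ x
  cases x <;> rfl

/-- Function kinds are full function spaces, so β is the substitution lemma and η is weakening with
extensionality. The equations of the recursor hold by computation of `Nat.rec`; those of its dual
follow because it is the pointwise `perp` of the recursor and `perp` interprets negation. -/
theorem interp_conv {Θ : List Kind} {σ : Kind} {T T' : Con Θ σ} (h : Conv T T') :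
    ∀ ρ : D.Env Θ, D.interp ρ T = D.interp ρ T' := by
  induction h with
  | beta T U => exact fun ρ => (D.interp_inst ρ T U).symm
  | eta T =>
    intro ρ
    funext v
    exact congrFun (D.interp_wk ρ v T) v
  | rec_zero => exact fun _ => rfl
  | rec_succ => exact fun _ => rfl
  | recDual_zero T U => exact fun ρ => (D.interp_neg ρ T).symm
  | recDual_succ T U n =>
    intro ρ
    exact (congrFun (congrFun (D.interp_neg ρ U) (D.interp ρ n)) (D.interp ρ (Con.rec3 T U n))).symm
  | refl => exact fun _ => rfl
  | symm _ ih => exact fun ρ => (ih ρ).symm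
  | trans _ _ ih ih' => exact fun ρ => (ih ρ).trans (ih' ρ)
  | lam _ ih => exact fun ρ => funext fun v => ih (ρ.cons v)
  | app _ _ ih ih' => intro ρ; simp only [interp, ih ρ, ih' ρ]
  | tensor _ _ ih ih' => intro ρ; simp only [interp, ih ρ, ih' ρ]
  | par _ _ ih ih' => intro ρ; simp only [interp, ih ρ, ih' ρ]
  | ex _ ih => intro ρ; simp only [interp, ih]
  | all _ ih => intro ρ; simp only [interp, ih]
  | down _ ih => intro ρ; simp only [interp, ih ρ]
  | up _ ih => intro ρ; simp only [interp, ih ρ]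

/-- The valuation `ρ[x ← v]`, where `x` is the variable number `n` of kind `τ`. -/
def Valuation.update {D : PropDomain B} (ρ : D.Valuation) (τ : Kind) (n : ℕ) (v : D.den τ) :
    D.Valuation :=
  fun τ' m => if h : τ = τ' ∧ n = m then h.1 ▸ v else ρ τ' m

/-- Bridge between the two kinds of variables: quantifier bodies are interpreted in extended
environments, whereas the rules speak of a named variable and so of an updated valuation. -/
theorem interp_abs {σ τ : Kind} (ρ : D.Valuation) (n : ℕ) (v : D.den τ) (T : Con [] σ) :
    D.interp (ρ.toEnv.cons v) (T.abs τ n) = D.interp (ρ.update τ n v).toEnv T := by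
  rw [Con.abs, interp_ren]
  congr 1
  funext τ' x
  cases x with
  | free m =>
    simp only [Con.absVar, Valuation.toEnv, Valuation.update]
    split_ifs with h
    · obtain ⟨rfl, rfl⟩ := h; rfl
    · rfl

theorem interp_subst {σ τ : Kind} (ρ : D.Valuation) (n : ℕ) (T : Con [] σ) (U : Con [] τ) :
    D.interp ρ.toEnv (T.subst τ n U) = D.interp (ρ.toEnv.cons (D.interp ρ.toEnv U)) (T.abs τ n) :=
  D.interp_inst _ _ _

/-- A bound variable is never the excluded named one, and both environments receive the same value
for it, so agreement survives binders. -/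
theorem interp_congr_of_not_occurs {τ : Kind} {n : ℕ} : ∀ {Θ : List Kind} {σ : Kind}
    {ρ ρ' : D.Env Θ} (T : Con Θ σ), (∀ τ' x, ¬ TVar.Is τ n x → ρ τ' x = ρ' τ' x) →
    ¬ T.Occurs τ n → D.interp ρ T = D.interp ρ' T
  | _, _, ρ, ρ', .var _ _ _ x, h, ho => by simp only [interp, h _ x ho]
  | _, _, ρ, ρ', .lam σ T, h, ho => funext fun v =>
      interp_congr_of_not_occurs T (cons_agree h v) ho
  | _, _, ρ, ρ', .app T U, h, ho => by
      simp only [interp, interp_congr_of_not_occurs T h fun i => ho (.inl i),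
        interp_congr_of_not_occurs U h fun i => ho (.inr i)]
  | _, _, _, _, .zero, _, _ => rfl
  | _, _, _, _, .succ, _, _ => rfl
  | _, _, _, _, .recr _ _ _, _, _ => rfl
  | _, _, ρ, ρ', .tensor T U, h, ho => by
      simp only [interp, interp_congr_of_not_occurs T h fun i => ho (.inl i),
        interp_congr_of_not_occurs U h fun i => ho (.inr i)]
  | _, _, ρ, ρ', .par T U, h, ho => by
      simp only [interp, interp_congr_of_not_occurs T h fun i => ho (.inl i),
        interp_congr_of_not_occurs U h fun i => ho (.inr i)]
  | _, _, ρ, ρ', .ex τ A, h, ho => by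
      simp only [interp, fun v => interp_congr_of_not_occurs A (cons_agree h v) ho]
  | _, _, ρ, ρ', .all τ A, h, ho => by
      simp only [interp, fun v => interp_congr_of_not_occurs A (cons_agree h v) ho]
  | _, _, ρ, ρ', .down A, h, ho => by simp only [interp, interp_congr_of_not_occurs A h ho]
  | _, _, ρ, ρ', .up A, h, ho => by simp only [interp, interp_congr_of_not_occurs A h ho]
where
  cons_agree {Θ : List Kind} {σ : Kind} {ρ ρ' : D.Env Θ}
      (h : ∀ τ' x, ¬ TVar.Is τ n x → ρ τ' x = ρ' τ' x) (v : D.den σ) :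
      ∀ τ' x, ¬ TVar.Is τ n x → ρ.cons v τ' x = ρ'.cons v τ' x
    | _, .here, _ => rfl
    | _, .there x, hx => h _ x hx

theorem interp_update_of_not_occurs {σ τ : Kind} {n : ℕ} (ρ : D.Valuation) (v : D.den τ)
    {T : Con [] σ} (h : ¬ T.Occurs τ n) :
    D.interp (ρ.update τ n v).toEnv T = D.interp ρ.toEnv T := by
  refine D.interp_congr_of_not_occurs T (fun τ' x hx => ?_) h
  cases x with
  | free m => exact dif_neg hx

end PropDomain

/-! ### Substitution in terms -/

namespace Syn

variable {Kp Kn : Type u}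

/-! ### Composition of renamings and substitutions. -/

theorem liftRen_liftRen {b b' b'' : List Pol} (r : (p : Pol) → Var b p → Var b' p)
    (r' : (p : Pol) → Var b' p → Var b'' p) (q : Pol) :
    (fun p x => liftRen r' q p (liftRen r q p x)) = liftRen (fun p x => r' p (r p x)) q := by
  funext p x
  cases x <;> rfl

theorem ren_ren : ∀ {k : Cat} {b b' b'' : List Pol} (r : (p : Pol) → Var b p → Var b' p)
    (r' : (p : Pol) → Var b' p → Var b'' p) (t : Syn Kp Kn k b),
    (t.ren r).ren r' = t.ren (fun p x => r' p (r p x))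
  | _, _, _, _, _, _, .var _ => rfl
  | _, _, _, _, r, r', .pair V V' => congrArg₂ pair (ren_ren r r' V) (ren_ren r r' V')
  | _, _, _, _, r, r', .box V => congrArg box (ren_ren r r' V)
  | _, _, _, _, _, _, .kpos _ => rfl
  | _, _, _, _, r, r', .ofVal V => congrArg ofVal (ren_ren r r' V)
  | _, _, _, _, r, r', .muNeg c => by simp only [ren, ren_ren _ _ c, liftRen_liftRen]
  | _, _, _, _, r, r', .muPair p q c => by simp only [ren, ren_ren _ _ c, liftRen_liftRen]
  | _, _, _, _, r, r', .muBox p c => by simp only [ren, ren_ren _ _ c, liftRen_liftRen]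
  | _, _, _, _, r, r', .muPos c => by simp only [ren, ren_ren _ _ c, liftRen_liftRen]
  | _, _, _, _, _, _, .kneg _ => rfl
  | _, _, _, _, r, r', .cut t u => congrArg₂ cut (ren_ren r r' t) (ren_ren r r' u)

theorem liftSub_liftRen {b b' b'' : List Pol} (r : (p : Pol) → Var b p → Var b' p)
    (θ : (p : Pol) → Var b' p → Syn Kp Kn (.val p) b'') (q : Pol) :
    (fun p x => liftSub θ q p (liftRen r q p x)) = liftSub (fun p x => θ p (r p x)) q := by
  funext p x
  cases x <;> rfl

theorem sub_ren : ∀ {k : Cat} {b b' b'' : List Pol} (r : (p : Pol) → Var b p → Var b' p)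
    (θ : (p : Pol) → Var b' p → Syn Kp Kn (.val p) b'') (t : Syn Kp Kn k b),
    (t.ren r).sub θ = t.sub (fun p x => θ p (r p x))
  | _, _, _, _, _, _, .var _ => rfl
  | _, _, _, _, r, θ, .pair V V' => congrArg₂ pair (sub_ren r θ V) (sub_ren r θ V')
  | _, _, _, _, r, θ, .box V => congrArg box (sub_ren r θ V)
  | _, _, _, _, _, _, .kpos _ => rfl
  | _, _, _, _, r, θ, .ofVal V => congrArg ofVal (sub_ren r θ V)
  | _, _, _, _, r, θ, .muNeg c => by simp only [ren, sub, sub_ren _ _ c, liftSub_liftRen]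
  | _, _, _, _, r, θ, .muPair p q c => by simp only [ren, sub, sub_ren _ _ c, liftSub_liftRen]
  | _, _, _, _, r, θ, .muBox p c => by simp only [ren, sub, sub_ren _ _ c, liftSub_liftRen]
  | _, _, _, _, r, θ, .muPos c => by simp only [ren, sub, sub_ren _ _ c, liftSub_liftRen]
  | _, _, _, _, _, _, .kneg _ => rfl
  | _, _, _, _, r, θ, .cut t u => congrArg₂ cut (sub_ren r θ t) (sub_ren r θ u)

theorem liftSub_ren {b b' b'' : List Pol} (θ : (p : Pol) → Var b p → Syn Kp Kn (.val p) b')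
    (r : (p : Pol) → Var b' p → Var b'' p) (q : Pol) :
    (fun p x => (liftSub θ q p x).ren (liftRen r q)) = liftSub (fun p x => (θ p x).ren r) q := by
  funext p x
  cases x with
  | here => rfl
  | there x => simp only [liftSub, ren_ren, liftRen]

theorem ren_sub : ∀ {k : Cat} {b b' b'' : List Pol}
    (θ : (p : Pol) → Var b p → Syn Kp Kn (.val p) b') (r : (p : Pol) → Var b' p → Var b'' p)
    (t : Syn Kp Kn k b), (t.sub θ).ren r = t.sub (fun p x => (θ p x).ren r)
  | _, _, _, _, _, _, .var _ => rfl
  | _, _, _, _, θ, r, .pair V V' => congrArg₂ pair (ren_sub θ r V) (ren_sub θ r V')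
  | _, _, _, _, θ, r, .box V => congrArg box (ren_sub θ r V)
  | _, _, _, _, _, _, .kpos _ => rfl
  | _, _, _, _, θ, r, .ofVal V => congrArg ofVal (ren_sub θ r V)
  | _, _, _, _, θ, r, .muNeg c => by simp only [ren, sub, ren_sub _ _ c, liftSub_ren]
  | _, _, _, _, θ, r, .muPair p q c => by simp only [ren, sub, ren_sub _ _ c, liftSub_ren]
  | _, _, _, _, θ, r, .muBox p c => by simp only [ren, sub, ren_sub _ _ c, liftSub_ren]
  | _, _, _, _, θ, r, .muPos c => by simp only [ren, sub, ren_sub _ _ c, liftSub_ren]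
  | _, _, _, _, _, _, .kneg _ => rfl
  | _, _, _, _, θ, r, .cut t u => congrArg₂ cut (ren_sub θ r t) (ren_sub θ r u)

theorem liftSub_sub {b b' b'' : List Pol} (θ : (p : Pol) → Var b p → Syn Kp Kn (.val p) b')
    (θ' : (p : Pol) → Var b' p → Syn Kp Kn (.val p) b'') (q : Pol) :
    (fun p x => (liftSub θ q p x).sub (liftSub θ' q)) =
      liftSub (fun p x => (θ p x).sub θ') q := by
  funext p x
  cases x with
  | here => rfl
  | there x => simp only [liftSub, sub_ren, ren_sub]

/-- Under a binder a weakening has to be moved past a substitution, which is what `sub_ren` and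
`ren_sub` provide. -/
theorem sub_sub : ∀ {k : Cat} {b b' b'' : List Pol}
    (θ : (p : Pol) → Var b p → Syn Kp Kn (.val p) b')
    (θ' : (p : Pol) → Var b' p → Syn Kp Kn (.val p) b'')
    (t : Syn Kp Kn k b), (t.sub θ).sub θ' = t.sub (fun p x => (θ p x).sub θ')
  | _, _, _, _, _, _, .var _ => rfl
  | _, _, _, _, θ, θ', .pair V V' => congrArg₂ pair (sub_sub θ θ' V) (sub_sub θ θ' V')
  | _, _, _, _, θ, θ', .box V => congrArg box (sub_sub θ θ' V)
  | _, _, _, _, _, _, .kpos _ => rfl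
  | _, _, _, _, θ, θ', .ofVal V => congrArg ofVal (sub_sub θ θ' V)
  | _, _, _, _, θ, θ', .muNeg c => by simp only [sub, sub_sub _ _ c, liftSub_sub]
  | _, _, _, _, θ, θ', .muPair p q c => by simp only [sub, sub_sub _ _ c, liftSub_sub]
  | _, _, _, _, θ, θ', .muBox p c => by simp only [sub, sub_sub _ _ c, liftSub_sub]
  | _, _, _, _, θ, θ', .muPos c => by simp only [sub, sub_sub _ _ c, liftSub_sub]
  | _, _, _, _, _, _, .kneg _ => rfl
  | _, _, _, _, θ, θ', .cut t u => congrArg₂ cut (sub_sub θ θ' t) (sub_sub θ θ' u)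

theorem liftSub_var {b : List Pol} (q : Pol) :
    liftSub (Kp := Kp) (Kn := Kn) (b := b) (fun _ x => .var x) q = fun _ x => .var x := by
  funext p x
  cases x <;> rfl

theorem sub_var : ∀ {k : Cat} {b : List Pol} (t : Syn Kp Kn k b), t.sub (fun _ x => .var x) = t
  | _, _, .var _ => rfl
  | _, _, .pair V V' => congrArg₂ pair (sub_var V) (sub_var V')
  | _, _, .box V => congrArg box (sub_var V)
  | _, _, .kpos _ => rfl
  | _, _, .ofVal V => congrArg ofVal (sub_var V)
  | _, _, .muNeg c => by simp only [sub, liftSub_var, sub_var c]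
  | _, _, .muPair p q c => by simp only [sub, liftSub_var, sub_var c]
  | _, _, .muBox p c => by simp only [sub, liftSub_var, sub_var c]
  | _, _, .muPos c => by simp only [sub, liftSub_var, sub_var c]
  | _, _, .kneg _ => rfl
  | _, _, .cut t u => congrArg₂ cut (sub_var t) (sub_var u)

/-! ### Dependence of substitution on the free names, and closedness of the result. -/

theorem liftSub_congr {b b' : List Pol} {θ θ' : (p : Pol) → Var b p → Syn Kp Kn (.val p) b'}
    {s : Finset Name} (h : ∀ p x, Var.fv x ⊆ s → θ p x = θ' p x) (q : Pol) :
    ∀ p x, Var.fv x ⊆ s → liftSub θ q p x = liftSub θ' q p x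
  | _, .here, _ => rfl
  | _, .there x, hx => by simp only [liftSub, h _ x hx]

/-- Lets a finite substitution and a total assignment be exchanged on a scoped subject. Bound
variables have no free name and are fixed by lifting, so the hypothesis passes under binders. -/
theorem sub_congr {s : Finset Name} : ∀ {k : Cat} {b b' : List Pol}
    {θ θ' : (p : Pol) → Var b p → Syn Kp Kn (.val p) b'} (t : Syn Kp Kn k b), t.fv ⊆ s →
    (∀ p x, Var.fv x ⊆ s → θ p x = θ' p x) → t.sub θ = t.sub θ'
  | _, _, _, _, _, .var x, hs, h => h _ x hs
  | _, _, _, _, _, .pair V V', hs, h =>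
      congrArg₂ pair (sub_congr V (Finset.union_subset_left hs) h)
        (sub_congr V' (Finset.union_subset_right hs) h)
  | _, _, _, _, _, .box V, hs, h => congrArg box (sub_congr V hs h)
  | _, _, _, _, _, .kpos _, _, _ => rfl
  | _, _, _, _, _, .ofVal V, hs, h => congrArg ofVal (sub_congr V hs h)
  | _, _, _, _, _, .muNeg c, hs, h => congrArg muNeg (sub_congr c hs (liftSub_congr h _))
  | _, _, _, _, _, .muPair p q c, hs, h =>
      congrArg (muPair p q) (sub_congr c hs (liftSub_congr (liftSub_congr h _) _))
  | _, _, _, _, _, .muBox p c, hs, h => congrArg (muBox p) (sub_congr c hs (liftSub_congr h _))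
  | _, _, _, _, _, .muPos c, hs, h => congrArg muPos (sub_congr c hs (liftSub_congr h _))
  | _, _, _, _, _, .kneg _, _, _ => rfl
  | _, _, _, _, _, .cut t u, hs, h =>
      congrArg₂ cut (sub_congr t (Finset.union_subset_left hs) h)
        (sub_congr u (Finset.union_subset_right hs) h)

theorem liftRen_fv {b b' : List Pol} {r : (p : Pol) → Var b p → Var b' p}
    (h : ∀ p x, (r p x).fv = x.fv) (q : Pol) : ∀ p x, (liftRen r q p x).fv = x.fv
  | _, .here => rfl
  | _, .there x => h _ x

theorem ren_fv : ∀ {k : Cat} {b b' : List Pol} {r : (p : Pol) → Var b p → Var b' p}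
    (t : Syn Kp Kn k b), (∀ p x, (r p x).fv = x.fv) → (t.ren r).fv = t.fv
  | _, _, _, _, .var x, h => h _ x
  | _, _, _, _, .pair V V', h => congrArg₂ (· ∪ ·) (ren_fv V h) (ren_fv V' h)
  | _, _, _, _, .box V, h => ren_fv V h
  | _, _, _, _, .kpos _, _ => rfl
  | _, _, _, _, .ofVal V, h => ren_fv V h
  | _, _, _, _, .muNeg c, h => ren_fv c (liftRen_fv h _)
  | _, _, _, _, .muPair _ _ c, h => ren_fv c (liftRen_fv (liftRen_fv h _) _)
  | _, _, _, _, .muBox _ c, h => ren_fv c (liftRen_fv h _)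
  | _, _, _, _, .muPos c, h => ren_fv c (liftRen_fv h _)
  | _, _, _, _, .kneg _, _ => rfl
  | _, _, _, _, .cut t u, h => congrArg₂ (· ∪ ·) (ren_fv t h) (ren_fv u h)

theorem ren_there_fv {k : Cat} {b : List Pol} (q : Pol) (t : Syn Kp Kn k b) :
    (t.ren (fun _ x => (.there x : Var (q :: b) _))).fv = t.fv :=
  ren_fv t fun _ _ => rfl

theorem liftSub_fv {b b' : List Pol} {θ : (p : Pol) → Var b p → Syn Kp Kn (.val p) b'}
    {s : Finset Name} (h : ∀ p x, Var.fv x ⊆ s → (θ p x).fv = ∅) (q : Pol) :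
    ∀ p x, Var.fv x ⊆ s → (liftSub θ q p x).fv = ∅
  | _, .here, _ => rfl
  | _, .there x, hx => (ren_there_fv q _).trans (h _ x hx)

/-- Supplies the closed redexes required by anti-evaluation. -/
theorem sub_fv_eq_empty {s : Finset Name} : ∀ {k : Cat} {b b' : List Pol}
    {θ : (p : Pol) → Var b p → Syn Kp Kn (.val p) b'} (t : Syn Kp Kn k b), t.fv ⊆ s →
    (∀ p x, Var.fv x ⊆ s → (θ p x).fv = ∅) → (t.sub θ).fv = ∅
  | _, _, _, _, .var x, hs, h => h _ x hs
  | _, _, _, _, .pair V V', hs, h =>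
      Finset.union_eq_empty.2 ⟨sub_fv_eq_empty V (Finset.union_subset_left hs) h,
        sub_fv_eq_empty V' (Finset.union_subset_right hs) h⟩
  | _, _, _, _, .box V, hs, h => sub_fv_eq_empty V hs h
  | _, _, _, _, .kpos _, _, _ => rfl
  | _, _, _, _, .ofVal V, hs, h => sub_fv_eq_empty V hs h
  | _, _, _, _, .muNeg c, hs, h => sub_fv_eq_empty c hs (liftSub_fv h _)
  | _, _, _, _, .muPair _ _ c, hs, h => sub_fv_eq_empty c hs (liftSub_fv (liftSub_fv h _) _)
  | _, _, _, _, .muBox _ c, hs, h => sub_fv_eq_empty c hs (liftSub_fv h _)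
  | _, _, _, _, .muPos c, hs, h => sub_fv_eq_empty c hs (liftSub_fv h _)
  | _, _, _, _, .kneg _, _, _ => rfl
  | _, _, _, _, .cut t u, hs, h =>
      Finset.union_eq_empty.2 ⟨sub_fv_eq_empty t (Finset.union_subset_left hs) h,
        sub_fv_eq_empty u (Finset.union_subset_right hs) h⟩

end Syn

/-! ### Assignments of values to named variables -/

/-- Assignments of values to all the named variables. -/
abbrev Assign (Kp Kn : Type u) : Type u := (p : Pol) → Var [] p → Val Kp Kn p

section Assign

variable {Kp Kn : Type u}

/-- The assignment `θ[(p, n) ← V]`. -/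
def Assign.update (θ : Assign Kp Kn) (p : Pol) (n : ℕ) (V : Val Kp Kn p) : Assign Kp Kn
  | q, .free m => if h : p = q ∧ n = m then h.1 ▸ V else θ q (.free m)

theorem Assign.update_same (θ : Assign Kp Kn) (p : Pol) (n : ℕ) (V : Val Kp Kn p) :
    θ.update p n V p (.free n) = V :=
  dif_pos ⟨rfl, rfl⟩

theorem Assign.update_ne (θ : Assign Kp Kn) {p : Pol} {n : ℕ} (V : Val Kp Kn p) {q : Pol} {m : ℕ}
    (h : (q, m) ≠ (p, n)) : θ.update p n V q (.free m) = θ q (.free m) :=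
  dif_neg fun h' => h (Prod.ext h'.1.symm h'.2.symm)

namespace Syn

theorem ren_there_inst {p q : Pol} (W : Val Kp Kn q) (V : Val Kp Kn p) :
    (W.ren (fun _ x => (.there x : Var [p] _))).sub (instSub V) = W :=
  (sub_ren _ _ W).trans (sub_var W)

/-- Identifies the reduct of a `μ` redex with the premise under an updated assignment. No freshness
is needed: the values of `θ` are weakened when they enter the binder, and instantiation undoes the
weakening. -/
theorem abs_sub_inst (θ : Assign Kp Kn) (p : Pol) (n : ℕ) (V : Val Kp Kn p) (c : Cmd Kp Kn) :
    ((c.abs p n).sub (liftSub θ p)).inst V = c.sub (θ.update p n V) := by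
  rw [abs, inst, sub_ren, sub_sub]
  congr 1
  funext q x
  cases x with
  | free m =>
    simp only [absVar, Assign.update]
    split_ifs with h
    · obtain ⟨rfl, rfl⟩ := h; rfl
    · exact ren_there_inst _ V

/-- The update at `(p, n)` is outermost because `absVar₂` tests that name first; in this order the
equation holds even when the two names coincide. -/
theorem abs₂_sub_inst₂ (θ : Assign Kp Kn) (p : Pol) (n : ℕ) (p' : Pol) (n' : ℕ)
    (V : Val Kp Kn p) (V' : Val Kp Kn p') (c : Cmd Kp Kn) :
    ((c.abs₂ p n p' n').sub (liftSub (liftSub θ p') p)).inst₂ V V' =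
      c.sub (Assign.update (θ.update p' n' V') p n V) := by
  rw [abs₂, inst₂, sub_ren, sub_sub]
  congr 1
  funext q x
  cases x with
  | free m =>
    simp only [absVar₂, Assign.update]
    split_ifs with h h'
    · obtain ⟨rfl, rfl⟩ := h; rfl
    · obtain ⟨rfl, rfl⟩ := h'; rfl
    · simp only [liftSub, ren_ren, sub_ren]
      exact sub_var _

theorem abs_sub_fv {θ : Assign Kp Kn} {p : Pol} {n : ℕ} {s : Finset Name} {c : Cmd Kp Kn}
    (hc : c.fv ⊆ insert (p, n) s) (h : ∀ q x, Var.fv x ⊆ s → (θ q x).fv = ∅) :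
    ((c.abs p n).sub (liftSub θ p)).fv = ∅ := by
  rw [abs, sub_ren]
  refine sub_fv_eq_empty c hc fun q x hx => ?_
  cases x with
  | free m =>
    simp only [absVar]
    split_ifs with h'
    · obtain ⟨rfl, rfl⟩ := h'; rfl
    · refine (ren_there_fv _ _).trans (h q _ ?_)
      rw [Var.fv, Finset.singleton_subset_iff] at hx ⊢
      exact Finset.mem_of_mem_insert_of_ne hx fun e => h' (by cases e; exact ⟨rfl, rfl⟩)

theorem abs₂_sub_fv {θ : Assign Kp Kn} {p p' : Pol} {n n' : ℕ} {s : Finset Name} {c : Cmd Kp Kn}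
    (hc : c.fv ⊆ insert (p, n) (insert (p', n') s))
    (h : ∀ q x, Var.fv x ⊆ s → (θ q x).fv = ∅) :
    ((c.abs₂ p n p' n').sub (liftSub (liftSub θ p') p)).fv = ∅ := by
  rw [abs₂, sub_ren]
  refine sub_fv_eq_empty c hc fun q x hx => ?_
  cases x with
  | free m =>
    simp only [absVar₂]
    split_ifs with h₁ h₂
    · obtain ⟨rfl, rfl⟩ := h₁; rfl
    · obtain ⟨rfl, rfl⟩ := h₂; rfl
    · refine (ren_there_fv _ _).trans ((ren_there_fv _ _).trans (h q _ ?_))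
      rw [Var.fv, Finset.singleton_subset_iff] at hx ⊢
      exact Finset.mem_of_mem_insert_of_ne
        (Finset.mem_of_mem_insert_of_ne hx fun e => h₁ (by cases e; exact ⟨rfl, rfl⟩))
        fun e => h₂ (by cases e; exact ⟨rfl, rfl⟩)

theorem toTm_sub (θ : Assign Kp Kn) : ∀ {p : Pol} (V : Val Kp Kn p),
    (V.toTm : Tm Kp Kn p).sub θ = (V.sub θ).toTm
  | .pos, _ => rfl
  | .neg, _ => rfl

theorem toTm_fv : ∀ {p : Pol} (V : Val Kp Kn p), (V.toTm : Tm Kp Kn p).fv = V.fv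
  | .pos, _ => rfl
  | .neg, _ => rfl

end Syn

end Assign

/-! ### Elements of the interpretation of formulas -/

namespace PropDomain

section Quant

variable {Kp Kn : Type u} {M : Type v} [QuantMonoid M] {B : QPole Kp Kn M} (D : PropDomain B)

theorem closed_of_mem_toSet : ∀ {p : Pol} (X : D.den (.prop p)) {w : Tm Kp Kn p × M},
    w ∈ D.toSet X → w.1.Closed
  | .pos, X, _, hw => (D.closed_value X.1 X.2 _ hw).1
  | .neg, _, _, hw => hw.1

theorem isValue_of_mem_toSet : ∀ {p : Pol} (X : D.den (.prop p)) {w : Tm Kp Kn p × M},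
    w ∈ D.toSet X → Syn.IsValue w.1
  | .pos, X, _, hw => (D.closed_value X.1 X.2 _ hw).2
  | .neg, _, w, _ => ⟨w.1, rfl⟩

/-- The elements of a set are in its biorthogonal. -/
theorem mem_biorth_of_mem : ∀ {p : Pol} (X : D.den (.prop p)) {w : Tm Kp Kn p × M},
    w ∈ D.toSet X → w ∈ B.biorth (D.toSet X)
  | .pos, X, w, hw => ⟨D.closed_of_mem_toSet X hw, fun x hx => by
      -- Exchanging the two sides of `com` is definitional once the polarity is known, so only the
      -- sum of the weights has to be commuted.
      rw [add_comm]; exact hx.2 w hw⟩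
  | .neg, X, w, hw => ⟨D.closed_of_mem_toSet (p := .neg) X hw, fun x hx => by
      rw [add_comm]; exact hx.2 w hw⟩

theorem biorth_mono : ∀ {p : Pol} {X Y : WSet Kp Kn M p}, X ⊆ Y → B.biorth X ⊆ B.biorth Y
  | .pos, _, _, h => fun _ hw => ⟨hw.1, fun x hx => hw.2 x ⟨hx.1, fun y hy => hx.2 y (h hy)⟩⟩
  | .neg, _, _, h => fun _ hw => ⟨hw.1, fun x hx => hw.2 x ⟨hx.1, fun y hy => hx.2 y (h hy)⟩⟩

/-- In the negative case `∃` is the orthogonal of the intersection of the recorded positive sets,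
and taking orthogonals reverses inclusions. -/
theorem toSet_subset_semEx {ι : Type*} (h : Nonempty ι) : ∀ {p : Pol} (F : ι → D.den (.prop p))
    (i : ι), D.toSet (F i) ⊆ D.toSet (D.semEx h F)
  | .pos, _, i => fun _ hw => ⟨_, ⟨i, rfl⟩, hw⟩
  | .neg, _, i => fun _ hw => ⟨hw.1, fun x hx => hw.2 x (hx _ ⟨i, rfl⟩)⟩

/-- In the negative case the orthogonal of a union is the intersection of the orthogonals. -/
theorem mem_semAll {ι : Type*} (h : Nonempty ι) : ∀ {p : Pol} (F : ι → D.den (.prop p))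
    {w : Tm Kp Kn p × M}, (∀ i, w ∈ D.toSet (F i)) → w ∈ D.toSet (D.semAll h F)
  | .pos, _, _, hw => by
      rintro _ ⟨i, rfl⟩
      exact hw i
  | .neg, _, _, hw => by
      -- Closedness is read off from one member of the family, so the family must be nonempty.
      refine ⟨(hw h.some).1, ?_⟩
      rintro x ⟨_, ⟨i, rfl⟩, hx⟩
      exact (hw i).2 x hx

end Quant

/-! ### Assignments that realize a context. -/

variable {Kp Kn : Type u} {B : SimplePole Kp Kn} (D : PropDomain B.quant)

/-- The assignment `θ` sends the variables declared in `Γ` to elements of the opposite sets. -/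
def Realizes (ρ : D.Valuation) (Γ : Ctx) (θ : Assign Kp Kn) : Prop :=
  ∀ d ∈ Γ, ((θ d.pol.opp (.free d.idx)).toTm, ()) ∈ D.interpFm ρ d.ty.neg

variable {D} {ρ : D.Valuation} {Γ Δ : Ctx} {θ : Assign Kp Kn}

theorem Realizes.mono (h : D.Realizes ρ Γ θ) (hs : Δ ⊆ Γ) : D.Realizes ρ Δ θ :=
  fun d hd => h d (hs hd)

theorem realizes_insert {d : Decl} : D.Realizes ρ (insert d Γ) θ ↔
    ((θ d.pol.opp (.free d.idx)).toTm, ()) ∈ D.interpFm ρ d.ty.neg ∧ D.Realizes ρ Γ θ :=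
  Finset.forall_mem_insert _ _ _

theorem Realizes.update (h : D.Realizes ρ Γ θ) {p : Pol} {n : ℕ} {V : Val Kp Kn p}
    (hn : (p, n) ∉ Γ.dom) : D.Realizes ρ Γ (θ.update p n V) := by
  intro d hd
  rw [Assign.update_ne]
  · exact h d hd
  · intro e
    exact hn (e ▸ Finset.mem_image_of_mem Decl.name hd)

theorem Realizes.insert_update (h : D.Realizes ρ Γ θ) {p : Pol} {n : ℕ} {A : Fm p}
    {V : Val Kp Kn p.opp} (hn : (p.opp, n) ∉ Γ.dom) (hV : (V.toTm, ()) ∈ D.interpFm ρ A.neg) :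
    D.Realizes ρ (insert ⟨p, n, A⟩ Γ) (θ.update p.opp n V) := by
  refine realizes_insert.2 ⟨?_, h.update hn⟩
  rw [Assign.update_same]
  exact hV

theorem Realizes.closed (h : D.Realizes ρ Γ θ) :
    ∀ (p : Pol) (x : Var [] p), x.fv ⊆ Γ.dom → (θ p x).fv = ∅
  | p, .free n, hx => by
      obtain ⟨d, hd, e⟩ := Finset.mem_image.1 (Finset.singleton_subset_iff.1 hx)
      have e₁ : d.pol.opp = p := congrArg Prod.fst e
      have e₂ : d.idx = n := congrArg Prod.snd e
      subst e₁ e₂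
      rw [← Syn.toTm_fv]
      exact D.closed_of_mem_toSet _ (h d hd)

theorem Realizes.congr {θ' : Assign Kp Kn} (h : D.Realizes ρ Γ θ)
    (e : ∀ p n, (p, n) ∈ Γ.dom → θ p (.free n) = θ' p (.free n)) : D.Realizes ρ Γ θ' := by
  intro d hd
  rw [← e _ _ (Finset.mem_image_of_mem Decl.name hd)]
  exact h d hd

end PropDomain

/-! ### Adequacy in terms of assignments -/

section Unit

variable {Kp Kn : Type u}

theorem Subst.Adequate.realizes {B : SimplePole Kp Kn} {D : PropDomain B.quant}
    {ρ : D.Valuation} {Γ : Ctx} {σ : Subst Kp Kn Unit} (h : σ.Adequate D ρ Γ) :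
    D.Realizes ρ Γ σ.fn := by
  intro d hd
  have hm : d.name ∈ σ.dom := h.1 ▸ Finset.mem_image_of_mem _ hd
  have e : σ.fn d.pol.opp (.free d.idx) = (σ.val d.name hm).1 := dif_pos hm
  rw [e]
  exact h.2 d hd hm

/-- The restriction of an assignment to a finite set of variables. -/
def Assign.toSubst (θ : Assign Kp Kn) (s : Finset Name) : Subst Kp Kn Unit where
  dom := s
  val x _ := (θ x.1 (.free x.2), ())

theorem Assign.toSubst_fn (θ : Assign Kp Kn) {s : Finset Name} :
    ∀ (p : Pol) (x : Var [] p), x.fv ⊆ s → (θ.toSubst s).fn p x = θ p x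
  | _, .free _, hx => dif_pos (Finset.singleton_subset_iff.1 hx)

theorem PropDomain.Realizes.toSubst_adequate {B : SimplePole Kp Kn} {D : PropDomain B.quant}
    {ρ : D.Valuation} {Γ : Ctx} {θ : Assign Kp Kn} (h : D.Realizes ρ Γ θ) :
    (θ.toSubst Γ.dom).Adequate D ρ Γ :=
  ⟨rfl, fun d hd _ => h d hd⟩

namespace Judgment

variable {B : SimplePole Kp Kn} {D : PropDomain B.quant} {Γ : Ctx}

theorem cmd_adequate_of {c : Cmd Kp Kn} {m : Unit}
    (h : ∀ ρ θ, D.Realizes ρ Γ θ → c.sub θ ∈ B.carrier) : (Judgment.cmd c Γ).Adequate D m :=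
  fun ρ _ hσ => ⟨h ρ _ hσ.realizes, rfl⟩

/-- With total assignments, splitting or extending a context requires no bookkeeping of domains.
Scoping makes the values outside the context irrelevant. -/
theorem Adequate.cmd {c : Cmd Kp Kn} {m : Unit} (h : (Judgment.cmd c Γ).Adequate D m)
    (hs : (Judgment.cmd c Γ).Scoped) {ρ : D.Valuation} {θ : Assign Kp Kn}
    (hθ : D.Realizes ρ Γ θ) : c.sub θ ∈ B.carrier :=
  Syn.sub_congr c hs θ.toSubst_fn ▸ (h ρ _ hθ.toSubst_adequate).1

theorem tm_adequate_of {p : Pol} {t : Tm Kp Kn p} {A : Fm p} {m : Unit}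
    (h : ∀ ρ θ, D.Realizes ρ Γ θ → (t.sub θ, ()) ∈ B.quant.biorth (D.interpFm ρ A) ∧
      (t.IsValue → (t.sub θ, ()) ∈ D.interpFm ρ A)) : (Judgment.tm p t A Γ).Adequate D m :=
  fun ρ _ hσ => ⟨(h ρ _ hσ.realizes).1, fun hv => ⟨(), le_rfl, (h ρ _ hσ.realizes).2 hv⟩⟩

/-- A set is contained in its biorthogonal, so membership gives both halves of adequacy. Only `μα`
and `∃` need the finer criterion `tm_adequate_of`. -/
theorem tm_adequate_of_mem {p : Pol} {t : Tm Kp Kn p} {A : Fm p} {m : Unit}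
    (h : ∀ ρ θ, D.Realizes ρ Γ θ → (t.sub θ, ()) ∈ D.interpFm ρ A) :
    (Judgment.tm p t A Γ).Adequate D m :=
  tm_adequate_of fun ρ θ hθ => ⟨D.mem_biorth_of_mem _ (h ρ θ hθ), fun _ => h ρ θ hθ⟩

theorem Adequate.tm {p : Pol} {t : Tm Kp Kn p} {A : Fm p} {m : Unit}
    (h : (Judgment.tm p t A Γ).Adequate D m) (hs : (Judgment.tm p t A Γ).Scoped)
    {ρ : D.Valuation} {θ : Assign Kp Kn} (hθ : D.Realizes ρ Γ θ) :
    (t.sub θ, ()) ∈ B.quant.biorth (D.interpFm ρ A) ∧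
      (t.IsValue → (t.sub θ, ()) ∈ D.interpFm ρ A) := by
  have h' := h ρ _ hθ.toSubst_adequate
  have e : t.sub (θ.toSubst Γ.dom).fn = t.sub θ := Syn.sub_congr t hs θ.toSubst_fn
  rw [Subst.act, e] at h'
  -- The smaller weight given by `upClosure` can only be `()`.
  exact ⟨h'.1, fun hv => (h'.2 hv).choose_spec.2⟩

theorem Adequate.val {p : Pol} {V : Val Kp Kn p} {A : Fm p} {m : Unit}
    (h : (Judgment.tm p V.toTm A Γ).Adequate D m) (hs : (Judgment.tm p V.toTm A Γ).Scoped)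
    {ρ : D.Valuation} {θ : Assign Kp Kn} (hθ : D.Realizes ρ Γ θ) :
    ((V.sub θ).toTm, ()) ∈ D.interpFm ρ A :=
  Syn.toTm_sub θ V ▸ (h.tm hs hθ).2 ⟨V, rfl⟩

end Judgment

end Unit

/-! ### Adequacy of the rules -/

namespace Judgment

variable {Kp Kn : Type u} {B : SimplePole Kp Kn} {D : PropDomain B.quant} {Γ Δ : Ctx}
  {m m' : Unit}

theorem adequate_axPos (n : ℕ) (P : Fm .pos) :
    (Judgment.tm .pos (.ofVal (.var (.free n))) P {⟨.neg, n, P.neg⟩} :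
      Judgment Kp Kn).Adequate D m :=
  tm_adequate_of_mem fun ρ θ hθ => by
    -- The realizer lies in the interpretation of `P.neg.neg`; two uses of `interp_neg` produce a
    -- double `perp`, which unfolds to the interpretation of `P`.
    have h := hθ _ (Finset.mem_singleton_self _)
    simp only [PropDomain.interpFm, PropDomain.interp_neg] at h
    exact h

theorem adequate_axNeg (n : ℕ) (N : Fm .neg) :
    (Judgment.tm .neg (.var (.free n)) N {⟨.pos, n, N.neg⟩} : Judgment Kp Kn).Adequate D m :=
  tm_adequate_of_mem fun ρ θ hθ => by
    have h := hθ _ (Finset.mem_singleton_self _)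
    simp only [PropDomain.interpFm, PropDomain.interp_neg] at h
    exact h

theorem Adequate.muPos {c : Cmd Kp Kn} {n : ℕ} {P : Fm .pos} (hn : (Pol.neg, n) ∉ Γ.dom)
    (hs : (Judgment.cmd c (insert ⟨.pos, n, P⟩ Γ)).Scoped)
    (h : (Judgment.cmd c (insert ⟨.pos, n, P⟩ Γ)).Adequate D m) :
    (Judgment.tm .pos (.muNeg (c.abs .neg n)) P Γ).Adequate D m' := by
  -- `μα.c` is not a value, so only the biorthogonal clause remains. Its tests are negative terms,
  -- hence values, and the `μ` step always fires.
  refine tm_adequate_of fun ρ θ hθ => ⟨?_, fun ⟨V, hV⟩ => nomatch hV⟩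
  have hc : ((c.abs .neg n).sub (Syn.liftSub θ .neg)).fv = ∅ :=
    Syn.abs_sub_fv (hs.trans_eq (Finset.image_insert _ _ _)) hθ.closed
  refine ⟨hc, fun ⟨t, _⟩ ht => ⟨?_, rfl⟩⟩
  refine B.anti_eval _ _ (Finset.union_eq_empty.2 ⟨hc, ht.1⟩) (.inr (.pos _ t)) ?_
  rw [Syn.abs_sub_inst]
  refine h.cmd hs (hθ.insert_update (p := .pos) hn ?_)
  rw [PropDomain.interpFm, PropDomain.interp_neg]
  exact ht

theorem Adequate.muNeg {c : Cmd Kp Kn} {n : ℕ} {N : Fm .neg} (hn : (Pol.pos, n) ∉ Γ.dom)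
    (hs : (Judgment.cmd c (insert ⟨.neg, n, N⟩ Γ)).Scoped)
    (h : (Judgment.cmd c (insert ⟨.neg, n, N⟩ Γ)).Adequate D m) :
    (Judgment.tm .neg (.muPos (c.abs .pos n)) N Γ).Adequate D m' := by
  refine tm_adequate_of_mem fun ρ θ hθ => ?_
  have hc : ((c.abs .pos n).sub (Syn.liftSub θ .pos)).fv = ∅ :=
    Syn.abs_sub_fv (hs.trans_eq (Finset.image_insert _ _ _)) hθ.closed
  refine ⟨hc, fun ⟨t, _⟩ ht => ⟨?_, rfl⟩⟩
  -- The tests come from the positive set recorded in the interpretation of `N`; they are therefore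
  -- values, which the step for `μx` requires.
  let X : D.den (.prop .pos) := D.perp (.prop .neg) (D.interp ρ.toEnv N)
  obtain ⟨V, rfl⟩ := D.isValue_of_mem_toSet X ht
  have hV := D.closed_of_mem_toSet X ht
  refine B.anti_eval _ _ (Finset.union_eq_empty.2 ⟨hV, hc⟩) (.inr (.neg V _)) ?_
  rw [Syn.abs_sub_inst]
  refine h.cmd hs (hθ.insert_update (p := .neg) hn ?_)
  rw [PropDomain.interpFm, PropDomain.interp_neg]
  exact ht

theorem Adequate.cut {p : Pol} {t : Tm Kp Kn p} {u : Tm Kp Kn p.opp} {A : Fm p} {l : Unit}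
    (hst : (Judgment.tm p t A Γ).Scoped) (hsu : (Judgment.tm p.opp u A.neg Δ).Scoped)
    (ht : (Judgment.tm p t A Γ).Adequate D m) (hu : (Judgment.tm p.opp u A.neg Δ).Adequate D m') :
    (Judgment.cmd (Syn.com t u) (Γ ∪ Δ)).Adequate D l := by
  refine cmd_adequate_of fun ρ θ hθ => ?_
  have ht := ht.tm hst (hθ.mono Finset.subset_union_left)
  have hu := hu.tm hsu (hθ.mono Finset.subset_union_right)
  rw [PropDomain.interpFm, PropDomain.interp_neg] at hu
  -- The negative side is a value, so it lies in the orthogonal set itself; the positive side is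
  -- used through its biorthogonal.
  cases p with
  | pos => exact (ht.1.2 _ (hu.2 ⟨u, rfl⟩)).1
  | neg => exact (hu.1.2 _ (ht.2 ⟨t, rfl⟩)).1

theorem Adequate.tensor {p q : Pol} {V : Val Kp Kn p} {V' : Val Kp Kn q} {A : Fm p} {A' : Fm q}
    {l : Unit} (hs : (Judgment.tm p V.toTm A Γ).Scoped) (hs' : (Judgment.tm q V'.toTm A' Δ).Scoped)
    (h : (Judgment.tm p V.toTm A Γ).Adequate D m)
    (h' : (Judgment.tm q V'.toTm A' Δ).Adequate D m') :
    (Judgment.tm .pos (.ofVal (.pair V V')) (.tensor A A') (Γ ∪ Δ)).Adequate D l :=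
  tm_adequate_of_mem fun _ _ hθ =>
    ⟨_, (), _, (), h.val hs (hθ.mono Finset.subset_union_left),
      h'.val hs' (hθ.mono Finset.subset_union_right), rfl⟩

theorem Adequate.down {p : Pol} {V : Val Kp Kn p} {A : Fm p}
    (hs : (Judgment.tm p V.toTm A Γ).Scoped) (h : (Judgment.tm p V.toTm A Γ).Adequate D m) :
    (Judgment.tm .pos (.ofVal (.box V)) (.down A) Γ).Adequate D m' :=
  tm_adequate_of_mem fun _ _ hθ => ⟨_, (), h.val hs hθ, rfl⟩

/-- The interpretation of `⅋` is an orthogonal of a `tensorSet`, so all tests are pairs of values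
and the β step fires. -/
theorem Adequate.par {p q : Pol} {c : Cmd Kp Kn} {n n' : ℕ} {A : Fm p} {A' : Fm q}
    (hne : (p.opp, n) ≠ (q.opp, n')) (hn : (p.opp, n) ∉ Γ.dom) (hn' : (q.opp, n') ∉ Γ.dom)
    (hs : (Judgment.cmd c (insert ⟨p, n, A⟩ (insert ⟨q, n', A'⟩ Γ))).Scoped)
    (h : (Judgment.cmd c (insert ⟨p, n, A⟩ (insert ⟨q, n', A'⟩ Γ))).Adequate D m) :
    (Judgment.tm .neg (.muPair p.opp q.opp (c.abs₂ p.opp n q.opp n')) (.par A A') Γ).Adequate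
      D m' := by
  refine tm_adequate_of_mem fun ρ θ hθ => ?_
  have hc : ((c.abs₂ p.opp n q.opp n').sub
      (Syn.liftSub (Syn.liftSub θ q.opp) p.opp)).fv = ∅ :=
    Syn.abs₂_sub_fv (hs.trans_eq ((Finset.image_insert _ _ _).trans
      (congrArg _ (Finset.image_insert _ _ _)))) hθ.closed
  refine ⟨hc, fun w hw => ⟨?_, rfl⟩⟩
  obtain ⟨V, _, V', _, hV, hV', rfl⟩ := hw
  have hf : V.fv = ∅ := Syn.toTm_fv V ▸ D.closed_of_mem_toSet _ hV
  have hf' : V'.fv = ∅ := Syn.toTm_fv V' ▸ D.closed_of_mem_toSet _ hV'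
  refine B.anti_eval _ _ (Finset.union_eq_empty.2 ⟨Finset.union_eq_empty.2 ⟨hf, hf'⟩, hc⟩)
    (.inl (.par V V' _)) ?_
  rw [Syn.abs₂_sub_inst₂]
  -- The inner declaration is realized first, matching the order of the updates; `hne` then keeps
  -- the outer name fresh for the extended context.
  refine h.cmd hs (PropDomain.Realizes.insert_update (hθ.insert_update hn' ?_) ?_ ?_)
  · rw [PropDomain.interpFm, PropDomain.interp_neg]
    exact hV'
  · intro hm
    rcases Finset.mem_insert.1 ((Finset.image_insert _ _ _).subset hm) with e | e
    · exact hne e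
    · exact hn e
  · rw [PropDomain.interpFm, PropDomain.interp_neg]
    exact hV

theorem Adequate.up {p : Pol} {c : Cmd Kp Kn} {n : ℕ} {A : Fm p} (hn : (p.opp, n) ∉ Γ.dom)
    (hs : (Judgment.cmd c (insert ⟨p, n, A⟩ Γ)).Scoped)
    (h : (Judgment.cmd c (insert ⟨p, n, A⟩ Γ)).Adequate D m) :
    (Judgment.tm .neg (.muBox p.opp (c.abs p.opp n)) (.up A) Γ).Adequate D m' := by
  refine tm_adequate_of_mem fun ρ θ hθ => ?_
  have hc : ((c.abs p.opp n).sub (Syn.liftSub θ p.opp)).fv = ∅ :=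
    Syn.abs_sub_fv (hs.trans_eq (Finset.image_insert _ _ _)) hθ.closed
  refine ⟨hc, fun w hw => ⟨?_, rfl⟩⟩
  obtain ⟨V, _, hV, rfl⟩ := hw
  have hf : V.fv = ∅ := Syn.toTm_fv V ▸ D.closed_of_mem_toSet _ hV
  refine B.anti_eval _ _ (Finset.union_eq_empty.2 ⟨hf, hc⟩) (.inl (.up V _)) ?_
  rw [Syn.abs_sub_inst]
  refine h.cmd hs (hθ.insert_update hn ?_)
  rw [PropDomain.interpFm, PropDomain.interp_neg]
  exact hV

theorem Adequate.ex {p : Pol} {t : Tm Kp Kn p} {τ : Kind} {x : ℕ} {A : Fm p} {T : Con [] τ}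
    (hs : (Judgment.tm p t (A.subst τ x T) Γ).Scoped)
    (h : (Judgment.tm p t (A.subst τ x T) Γ).Adequate D m) :
    (Judgment.tm p t (.ex τ (A.abs τ x)) Γ).Adequate D m' := by
  refine tm_adequate_of fun ρ θ hθ => ?_
  have hsub : D.interpFm ρ (A.subst τ x T) ⊆ D.interpFm ρ (.ex τ (A.abs τ x)) := by
    rw [PropDomain.interpFm, PropDomain.interp_subst]
    -- The index of the union is the interpretation of the witness `T`, supplied by `interp_subst`.
    exact D.toSet_subset_semEx (D.den_nonempty τ)
      (fun v => D.interp (ρ.toEnv.cons v) (A.abs τ x)) _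
  have h := h.tm hs hθ
  exact ⟨PropDomain.biorth_mono hsub h.1, fun hv => hsub (h.2 hv)⟩

/-- The premise is used at every valuation `ρ[x ← v]` with the same assignment, which still realizes
`Γ` because `x` does not occur there. -/
theorem Adequate.all {p : Pol} {V : Val Kp Kn p} {τ : Kind} {x : ℕ} {A : Fm p}
    (hx : ¬ Γ.Occurs τ x) (hs : (Judgment.tm p V.toTm A Γ).Scoped)
    (h : (Judgment.tm p V.toTm A Γ).Adequate D m) :
    (Judgment.tm p V.toTm (.all τ (A.abs τ x)) Γ).Adequate D m' := by
  refine tm_adequate_of_mem fun ρ θ hθ => ?_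
  refine D.mem_semAll (D.den_nonempty τ) _ fun v => ?_
  rw [PropDomain.interp_abs, Syn.toTm_sub]
  refine h.val hs fun d hd => ?_
  have hd' : ¬ d.ty.Occurs τ x := fun ho => hx ⟨d, hd, ho⟩
  have := hθ d hd
  rw [PropDomain.interpFm, PropDomain.interp_neg] at this ⊢
  rw [D.interp_update_of_not_occurs ρ v hd']
  exact this

theorem Adequate.conv {p : Pol} {c : Cmd Kp Kn} {n : ℕ} {A A' : Fm p} (hA : Conv A A')
    (hs : (Judgment.cmd c (insert ⟨p, n, A⟩ Γ)).Scoped)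
    (h : (Judgment.cmd c (insert ⟨p, n, A⟩ Γ)).Adequate D m) :
    (Judgment.cmd c (insert ⟨p, n, A'⟩ Γ)).Adequate D m' := by
  refine cmd_adequate_of fun ρ θ hθ => h.cmd hs (ρ := ρ) ?_
  rw [PropDomain.realizes_insert] at hθ ⊢
  refine ⟨?_, hθ.2⟩
  have := hθ.1
  rw [PropDomain.interpFm, PropDomain.interp_neg] at this ⊢
  rw [D.interp_conv hA]
  exact this

theorem Adequate.weak {c : Cmd Kp Kn} {d : Decl} (hs : (Judgment.cmd c Γ).Scoped)
    (h : (Judgment.cmd c Γ).Adequate D m) : (Judgment.cmd c (insert d Γ)).Adequate D m' :=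
  cmd_adequate_of fun _ _ hθ => h.cmd hs (hθ.mono (Finset.subset_insert _ _))

/-- The assignment is precomposed with the renaming: both contracted names receive the realizer of
`n`, and the names of `Γ` are left alone since `n₁` and `n₂` are fresh for it. -/
theorem Adequate.contr {p : Pol} {c : Cmd Kp Kn} {n₁ n₂ n : ℕ} {A : Fm p}
    (hn₁ : (p.opp, n₁) ∉ Γ.dom) (hn₂ : (p.opp, n₂) ∉ Γ.dom)
    (hs : (Judgment.cmd c (insert ⟨p, n₁, A⟩ (insert ⟨p, n₂, A⟩ Γ))).Scoped)
    (h : (Judgment.cmd c (insert ⟨p, n₁, A⟩ (insert ⟨p, n₂, A⟩ Γ))).Adequate D m) :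
    (Judgment.cmd (c.contr p.opp n₁ n₂ n) (insert ⟨p, n, A⟩ Γ)).Adequate D m' := by
  refine cmd_adequate_of fun ρ θ hθ => ?_
  rw [Syn.contr, Syn.sub_ren]
  rw [PropDomain.realizes_insert] at hθ
  refine h.cmd hs (ρ := ρ)
    (PropDomain.realizes_insert.2 ⟨?_, PropDomain.realizes_insert.2 ⟨?_, ?_⟩⟩)
  · simpa [Syn.contrVar] using hθ.1
  · simpa [Syn.contrVar] using hθ.1
  · refine hθ.2.congr fun q k hk => ?_
    rw [Syn.contrVar, if_neg]
    rintro ⟨rfl, rfl | rfl⟩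
    · exact hn₁ hk
    · exact hn₂ hk

end Judgment

end PAw

theorem mainTheorem9 {Kp Kn : Type u} (B : PAw.SimplePole Kp Kn) (D : PAw.PropDomain B.quant)
    (R : PAw.Rule) : R.Adequate D (R.cost 0) := by
  intro J K hI hs m hm
  cases hI with
  | axPos n P => exact PAw.Judgment.adequate_axPos n P
  | axNeg n N => exact PAw.Judgment.adequate_axNeg n N
  -- `R.arity` reduces to a numeral only in each case, hence the explicit `Fin` types. The weights
  -- need no comparison, as the adequacy lemmas hold for any conclusion weight.
  | muPos c n P Γ hn => exact (hm (0 : Fin 1)).muPos hn (hs (0 : Fin 1))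
  | muNeg c n N Γ hn => exact (hm (0 : Fin 1)).muNeg hn (hs (0 : Fin 1))
  | cut t u A Γ Δ hd =>
    exact PAw.Judgment.Adequate.cut (hs (0 : Fin 2)) (hs (1 : Fin 2)) (hm (0 : Fin 2))
      (hm (1 : Fin 2))
  | tensor V V' A A' Γ Δ hd =>
    exact PAw.Judgment.Adequate.tensor (hs (0 : Fin 2)) (hs (1 : Fin 2)) (hm (0 : Fin 2))
      (hm (1 : Fin 2))
  | par c n n' A A' Γ hne hn hn' => exact (hm (0 : Fin 1)).par hne hn hn' (hs (0 : Fin 1))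
  | down V A Γ => exact (hm (0 : Fin 1)).down (hs (0 : Fin 1))
  | up c n A Γ hn => exact (hm (0 : Fin 1)).up hn (hs (0 : Fin 1))
  | ex t τ x A T Γ => exact (hm (0 : Fin 1)).ex (hs (0 : Fin 1))
  | all V τ x A Γ hx => exact (hm (0 : Fin 1)).all hx (hs (0 : Fin 1))
  | conv c n A A' Γ hn hA => exact (hm (0 : Fin 1)).conv hA (hs (0 : Fin 1))
  | weak c n A Γ hn => exact (hm (0 : Fin 1)).weak (hs (0 : Fin 1))
  | contr c n₁ n₂ n A Γ hne hn₁ hn₂ hn =>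
    exact (hm (0 : Fin 1)).contr hn₁ hn₂ (hs (0 : Fin 1))
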